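/- Consider a finite set $\mathcal A$ of $N\ge 2$ arms. The rewards $R_a(t)\in\{0,1\}$, $a\in\mathcal A$, $t=0,1,2,\dots$, are independent Bernoulli variables with means $r_a\in[0,1]$, and there is a unique optimal arm $a^\star$, i.e. $r_a<r^\star:=r_{a^\star}$ for all $a\ne a^\star$. Let $\Delta:=r^\star-\max_{a\ne a^\star}r_a>0$. The SAMBA algorithm with learning rate $\alpha\in(0,1)$ keeps a probability vector $p(t)=(p_a(t))_{a\in\mathcal A}$, where $p(0)$ is deterministic with strictly positive entries. At time $t$, given the history $H(t-1)$ of the arms played, the rewards observed and the tie-breaks made before time $t$, arm $a$ is played with probability $p_a(t)$ (write $I_a(t)$ for the indicator that arm $a$ is played at time $t$), and, independently, a leading arm $a_\star(t)$ is chosen uniformly at random among the maximizers of $a\mapsto p_a(t)$; these choices are independent of the rewards of time $t$. Then, for $a\neq a_\star(t)$, $$p_a(t+1)=p_a(t)+\alpha p_a(t)^2\left[\frac{I_a(t)R_a(t)}{p_a(t)}-\frac{I_{a_\star(t)}(t)R_{a_\star(t)}(t)}{p_{a_\star(t)}(t)}\right],\qquad p_{a_\star(t)}(t+1)=1-\sum_{a\ne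 a_\star(t)}p_a(t+1).$$ The regret is $\mathcal{R}g(T)=r^\star T-\mathbb E\big[\sum_{t=0}^{T-1}\sum_{a}I_a(t)R_a(t)\big]$. Suppose that $\alpha<\Delta/(r^\star-\Delta)$ (where the right-hand side is $+\infty$ if $r^\star=\Delta$). Then $(p(t))_{t\ge 0}$ is a time-homogeneous Markov chain (with respect to the history) on the probability simplex, and $p_{a^\star}(t)\to1$ as $t\to\infty$ with probability $1$. Moreover $Q:=\sum_{t=0}^\infty\mathbb P\big(p_{a^\star}(t)\le\tfrac12\big)<\infty$, and $$\mathcal{R}g(T)\le\frac{N}{\alpha\Delta}\log T+Q$$ for every integer $T\ge2$, and also for $T=1$ if $p_{a^\star}(0)\le\tfrac12$ (for instance, if $p(0)$ is uniform). -/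

import Mathlib

open MeasureTheory ProbabilityTheory Filter Topology

noncomputable section

namespace Samba

/-- `X` is a time-homogeneous Markov chain with respect to the family `H` of σ-algebras: `H` is a
filtration, `X` is adapted to it (so `H t` contains the information in `X 0, …, X t`), and the conditional law of `X (t + 1)` given `H t` is `κ (X t)` for a fixed Markov kernel `κ`. -/
def IsMarkovChain {Ω S : Type*} [mΩ : MeasurableSpace Ω] [MeasurableSpace S] (P : Measure Ω)
    (H : ℕ → MeasurableSpace Ω) (X : ℕ → Ω → S) : Prop :=
  Monotone H ∧ (∀ t, H t ≤ mΩ) ∧ (∀ t, Measurable[H t] (X t)) ∧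
  ∃ κ : Kernel S S, IsMarkovKernel κ ∧
    ∀ (t : ℕ) (B : Set S), MeasurableSet B →
      P[Set.indicator (X (t + 1) ⁻¹' B) (fun _ => (1 : ℝ)) | H t]
        =ᵐ[P] fun ω => (κ (X t ω)).real B

section

variable {𝒜 : Type*} [Fintype 𝒜]

/-- The gap `Δ` between the mean reward of the arm `aStar` and the best mean reward among the
other arms. -/
def gap (r : 𝒜 → ℝ) (aStar : 𝒜) : ℝ :=
  r aStar - ⨆ a : {a : 𝒜 // a ≠ aStar}, r a

open Classical in
/-- The arms of maximal probability. -/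
def leaders (p : 𝒜 → ℝ) : Finset 𝒜 :=
  Finset.univ.filter fun l => ∀ b, p b ≤ p l

open Classical in
/-- The uniform distribution on the arms of maximal probability. -/
def leaderWeight (p : 𝒜 → ℝ) (l : 𝒜) : ℝ :=
  if l ∈ leaders p then ((leaders p).card : ℝ)⁻¹ else 0

variable [DecidableEq 𝒜]

/-- The increment rule for an arm other than the leading arm `l`. Here `y a = I_a R_a` is the
observed reward: `0` if `a` is not played, and the reward received if `a` is played. -/
def stepOther (α : ℝ) (l : 𝒜) (y p : 𝒜 → ℝ) (a : 𝒜) : ℝ :=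
  p a + α * p a ^ 2 * (y a / p a - y l / p l)

/-- One SAMBA update; the leading arm receives the remaining probability. -/
def step (α : ℝ) (l : 𝒜) (y p : 𝒜 → ℝ) (a : 𝒜) : ℝ :=
  if a = l then 1 - ∑ b ∈ Finset.univ.erase l, stepOther α l y p b
  else stepOther α l y p a

variable {Ω : Type*}

/-- The observed reward `I_a(t) R_a(t)`, where `arm t` is the arm played at time `t`. -/
def observed (R : ℕ → 𝒜 → Ω → ℝ) (arm : ℕ → Ω → 𝒜) (t : ℕ) (ω : Ω) (a : 𝒜) : ℝ :=
  (if arm t ω = a then 1 else 0) * R t a ω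

/-- The SAMBA probability vector `p(t)` driven by the rewards `R`, the arms played `arm` and the
leading arms `lead`, with initial vector `p₀`. -/
def prob (α : ℝ) (p₀ : 𝒜 → ℝ) (R : ℕ → 𝒜 → Ω → ℝ) (arm lead : ℕ → Ω → 𝒜) :
    ℕ → Ω → 𝒜 → ℝ
  | 0, _ => p₀
  | t + 1, ω => step α (lead t ω) (observed R arm t ω) (prob α p₀ R arm lead t ω)

/-- The history available before the arm of time `t` is chosen: the arms played, the rewards
observed and the outcomes of the tie-breaks at the times `s < t`. -/
@[reducible]
def history [MeasurableSpace 𝒜] (R : ℕ → 𝒜 → Ω → ℝ) (arm lead : ℕ → Ω → 𝒜) (t : ℕ) :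
    MeasurableSpace Ω :=
  ⨆ s : Fin t, MeasurableSpace.comap
    (fun ω => (arm s ω, lead s ω, observed R arm s ω)) inferInstance

/-- A run of SAMBA with learning rate `α` and initial vector `p₀` on the Bernoulli bandit with
mean rewards `r`. -/
structure IsRun [MeasurableSpace 𝒜] [MeasurableSpace Ω] (P : Measure Ω) (r : 𝒜 → ℝ) (α : ℝ)
    (p₀ : 𝒜 → ℝ) (R : ℕ → 𝒜 → Ω → ℝ) (arm lead : ℕ → Ω → 𝒜) : Prop where
  measurable_reward : ∀ t a, Measurable (R t a)
  measurable_arm : ∀ t, Measurable (arm t)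
  measurable_lead : ∀ t, Measurable (lead t)
  /-- Rewards are Bernoulli with mean `r a`. -/
  reward_one : ∀ t a, P.real {ω | R t a ω = 1} = r a
  reward_zero : ∀ t a, P.real {ω | R t a ω = 0} = 1 - r a
  /-- All rewards are independent. -/
  reward_indep : iIndepFun (fun ta : ℕ × 𝒜 => R ta.1 ta.2) P
  /-- The choices at time `t` depend on the past and on extra randomization only: the rewards of
  time `t` are independent of the history, the arm played and the leading arm. -/
  nonanticipating : ∀ t, Indep (⨆ a, MeasurableSpace.comap (R t a) inferInstance)
    (history R arm lead t ⊔ MeasurableSpace.comap (arm t) inferInstance ⊔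
      MeasurableSpace.comap (lead t) inferInstance) P
  /-- Given the history, arm `a` is played with probability `p_a(t)` and, independently of the
  arm played, the leading arm is drawn uniformly from the arms of maximal probability. -/
  choice_law : ∀ (t : ℕ) (a l : 𝒜),
    P[Set.indicator {ω | arm t ω = a ∧ lead t ω = l} (fun _ => (1 : ℝ)) | history R arm lead t]
      =ᵐ[P] fun ω => prob α p₀ R arm lead t ω a * leaderWeight (prob α p₀ R arm lead t ω) l

/-- The regret by time `T`, where `aStar` is the optimal arm: `r* T` minus the expected cumulative
reward of the arms played at the times `0, …, T - 1`. -/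
def regret [MeasurableSpace Ω] (P : Measure Ω) (r : 𝒜 → ℝ) (aStar : 𝒜) (R : ℕ → 𝒜 → Ω → ℝ)
    (arm : ℕ → Ω → 𝒜) (T : ℕ) : ℝ :=
  r aStar * T - ∫ ω, ∑ t ∈ Finset.range T, ∑ a, observed R arm t ω a ∂P

end

/-- `Q`, the expected number of times at which the arm `aStar` has probability at most `1 / 2`. -/
def Q {𝒜 Ω : Type*} [MeasurableSpace Ω] (P : Measure Ω) (p : ℕ → Ω → 𝒜 → ℝ) (aStar : 𝒜) :
    ENNReal :=
  ∑' t : ℕ, P {ω | p t ω aStar ≤ 1 / 2}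

end Samba

end

/-!
Write `x` for the probability of the optimal arm, `q = 1 - x`, and `S = ∑ p_a²` over the other arms.
The proof uses three functions of the state whose one-step expectation (`expectNext`, a finite sum
over the arm played, the leading arm and the reward) decreases. Along the run such pointwise
inequalities turn into inequalities between expectations by `IsRun.lintegral_succ_add_le`, which
rests on the law of one step given the history, `IsRun.setLIntegral_prob_succ`. The latter also
gives the Markov property. The state stays in the open simplex because no entry exceeds the one of
the leading arm, so that an update loses at most a fraction `α` of any entry.

* `1 / x + M (1 - x)` with `M` large. When another arm, of probability `y` and mean `u`, leads, the
  drift of `1 / x` is `α (u / (1 - α x / y) - r* / (1 + α))`. The assumption on `α` says that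
  `(1 + α) u < r*`, so this is negative for small `x / y`; for the other values of `x / y` the
  probability `x` is bounded below and the drift `-α x² (r* - u)` of `1 - x` compensates. When the
  optimal arm leads, the drift of `1 / x` is `O(S)` and that of `1 - x` is at most `-α Δ S`.
  Hence the function decreases by a fixed amount whenever `x ≤ 1 / 2`, and `Q < ∞`
  (`exists_lyapunov`).
* `w = min q (1 / 2)`. Where `x > 1 / 2` the optimal arm leads and, by Cauchy-Schwarz,
  `E[w'] ≤ w - c w²` with `c = α Δ / (N - 1)`; where `x ≤ 1 / 2` the value `w` is maximal, so it
  cannot increase. So the squares `w²` over the times with `x > 1 / 2` have a finite sum; by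
  Borel-Cantelli these are eventually all times, and `q → 0` almost surely.
* `∑_{i < j} w / (1 + c i w)`, a concave function of `w`. By Jensen's inequality it bounds the
  expected sum of the values of `q` over the next `j` times, if only times with `x > 1 / 2` count.
  For `w = 1 / 2` and `j = T ≥ 2` it is at most `1 / 2 + (log T) / c ≤ N / (α Δ) log T`. The
  regret of a round is at most `q`, and the rounds with `x ≤ 1 / 2` contribute at most `Q`.
-/

namespace Samba

section

variable {𝒜 : Type*} [Fintype 𝒜]

/-! ### Updates of the probability vector -/

/-- The relative interior of the simplex, in which SAMBA moves. -/
def OpenSimplex (p : 𝒜 → ℝ) : Prop :=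
  (∀ a, 0 < p a) ∧ ∑ a, p a = 1

theorem mem_leaders {p : 𝒜 → ℝ} {l : 𝒜} : l ∈ leaders p ↔ ∀ b, p b ≤ p l := by
  simp [leaders]

theorem leaderWeight_nonneg (p : 𝒜 → ℝ) (l : 𝒜) : 0 ≤ leaderWeight p l := by
  unfold leaderWeight
  split_ifs <;> positivity

theorem leaderWeight_of_notMem {p : 𝒜 → ℝ} {l : 𝒜} (h : l ∉ leaders p) :
    leaderWeight p l = 0 := by
  simp [leaderWeight, h]

theorem sum_leaderWeight [Nonempty 𝒜] (p : 𝒜 → ℝ) : ∑ l, leaderWeight p l = 1 := by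
  classical
  obtain ⟨l, hl⟩ := Finite.exists_max p
  have hne : ((leaders p).card : ℝ) ≠ 0 := by
    exact_mod_cast Finset.card_ne_zero_of_mem (mem_leaders.2 hl)
  have h : ∑ l, leaderWeight p l = ∑ l ∈ leaders p, ((leaders p).card : ℝ)⁻¹ := by
    simp only [leaderWeight]
    rw [← Finset.sum_filter]
    congr 1
    ext
    simp
  rw [h, Finset.sum_const, nsmul_eq_mul, mul_inv_cancel₀ hne]

theorem OpenSimplex.le_one {p : 𝒜 → ℝ} (hp : OpenSimplex p) (a : 𝒜) : p a ≤ 1 := by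
  rw [← hp.2]
  exact Finset.single_le_sum (fun b _ => (hp.1 b).le) (Finset.mem_univ a)

theorem OpenSimplex.mem_stdSimplex {p : 𝒜 → ℝ} (hp : OpenSimplex p) : p ∈ stdSimplex ℝ 𝒜 :=
  ⟨fun a => (hp.1 a).le, hp.2⟩

/-- A leading arm has at least the average probability. -/
theorem OpenSimplex.one_le_card_mul {p : 𝒜 → ℝ} (hp : OpenSimplex p) {l : 𝒜}
    (hl : l ∈ leaders p) : 1 ≤ (Fintype.card 𝒜 : ℝ) * p l := by
  rw [← hp.2]
  calc ∑ a, p a ≤ ∑ _a : 𝒜, p l := Finset.sum_le_sum fun b _ => mem_leaders.1 hl b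
    _ = _ := by simp

/-- The probability that a Bernoulli variable of mean `x` equals `1` or `0` according to `b`. -/
noncomputable def bernoulliWeight (x : ℝ) (b : Bool) : ℝ := if b then x else 1 - x

/-- The probability, from state `p`, that arm `i.1` is played, arm `i.2.1` leads and the reward is
`i.2.2`. -/
noncomputable def weight (r : 𝒜 → ℝ) (p : 𝒜 → ℝ) (i : 𝒜 × 𝒜 × Bool) : ℝ :=
  p i.1 * leaderWeight p i.2.1 * bernoulliWeight (r i.1) i.2.2

variable {r : 𝒜 → ℝ} {α : ℝ} {p : 𝒜 → ℝ}

theorem bernoulliWeight_nonneg {x : ℝ} (h0 : 0 ≤ x) (h1 : x ≤ 1) (b : Bool) :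
    0 ≤ bernoulliWeight x b := by
  cases b <;> simp [bernoulliWeight, h0, h1]

theorem weight_nonneg (hr0 : ∀ a, 0 ≤ r a) (hr1 : ∀ a, r a ≤ 1) (hp : ∀ a, 0 ≤ p a)
    (i : 𝒜 × 𝒜 × Bool) : 0 ≤ weight r p i :=
  mul_nonneg (mul_nonneg (hp _) (leaderWeight_nonneg _ _))
    (bernoulliWeight_nonneg (hr0 _) (hr1 _) _)

theorem sum_weight [Nonempty 𝒜] (hp : ∑ a, p a = 1) : ∑ i, weight r p i = 1 := by
  simp only [Fintype.sum_prod_type, weight, Fintype.sum_bool, bernoulliWeight]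
  simp [← mul_add, ← Finset.mul_sum, sum_leaderWeight, hp]

variable [DecidableEq 𝒜]

theorem OpenSimplex.sum_erase {p : 𝒜 → ℝ} (hp : OpenSimplex p) (s : 𝒜) :
    ∑ a ∈ Finset.univ.erase s, p a = 1 - p s := by
  rw [← hp.2, ← Finset.add_sum_erase _ _ (Finset.mem_univ s)]
  ring

theorem step_single_self_of_ne {p : 𝒜 → ℝ} (hp : OpenSimplex p) (α : ℝ) {l b : 𝒜}
    (hb : b ≠ l) (y : ℝ) : step α l (Pi.single b y) p b = p b + α * y * p b := by
  have := (hp.1 b).ne'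
  simp only [step, stepOther, if_neg hb, Pi.single_eq_same, Pi.single_eq_of_ne hb.symm]
  field_simp
  simp

theorem step_single_leader_of_ne (p : 𝒜 → ℝ) (α : ℝ) {l b : 𝒜}
    (hb : b ≠ l) (y : ℝ) : step α l (Pi.single l y) p b = p b - α * y * p b ^ 2 / p l := by
  simp only [step, stepOther, if_neg hb, Pi.single_eq_same, Pi.single_eq_of_ne hb]
  ring

theorem step_single_of_ne (p : 𝒜 → ℝ) (α : ℝ) {a l b : 𝒜}
    (hb : b ≠ l) (hab : b ≠ a) (hal : a ≠ l) (y : ℝ) :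
    step α l (Pi.single a y) p b = p b := by
  simp [step, stepOther, if_neg hb, Pi.single_eq_of_ne hab, Pi.single_eq_of_ne hal.symm]

theorem sum_step (α : ℝ) (l : 𝒜) (y p : 𝒜 → ℝ) : ∑ a, step α l y p a = 1 := by
  rw [← Finset.add_sum_erase _ _ (Finset.mem_univ l)]
  have : ∑ a ∈ Finset.univ.erase l, step α l y p a =
      ∑ a ∈ Finset.univ.erase l, stepOther α l y p a :=
    Finset.sum_congr rfl fun a ha => by simp [step, Finset.ne_of_mem_erase ha]
  rw [this]
  simp [step]

theorem step_leader (α : ℝ) (l : 𝒜) (y p : 𝒜 → ℝ) :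
    step α l y p l = 1 - ∑ a ∈ Finset.univ.erase l, step α l y p a := by
  rw [← sum_step α l y p, ← Finset.add_sum_erase _ _ (Finset.mem_univ l)]
  ring

theorem step_single_leader {p : 𝒜 → ℝ} (hp : OpenSimplex p) (α : ℝ) (l : 𝒜) (y : ℝ) :
    step α l (Pi.single l y) p l =
      p l + α * y * (∑ b ∈ Finset.univ.erase l, p b ^ 2) / p l := by
  rw [step_leader]
  have : ∑ a ∈ Finset.univ.erase l, step α l (Pi.single l y) p a =
      ∑ a ∈ Finset.univ.erase l, (p a - α * y / p l * p a ^ 2) :=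
    Finset.sum_congr rfl fun a ha => by
      rw [step_single_leader_of_ne p α (Finset.ne_of_mem_erase ha)]
      ring
  rw [this, Finset.sum_sub_distrib, hp.sum_erase, ← Finset.mul_sum]
  ring

theorem step_single_ne_leader {p : 𝒜 → ℝ} (hp : OpenSimplex p) (α : ℝ) {a l : 𝒜}
    (hal : a ≠ l) (y : ℝ) : step α l (Pi.single a y) p l = p l - α * y * p a := by
  rw [step_leader]
  have : ∑ b ∈ Finset.univ.erase l, step α l (Pi.single a y) p b =
      ∑ b ∈ Finset.univ.erase l, (p b + if b = a then α * y * p a else 0) :=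
    Finset.sum_congr rfl fun b hb => by
      split_ifs with h
      · subst h
        exact step_single_self_of_ne hp α hal y
      · rw [step_single_of_ne p α (Finset.ne_of_mem_erase hb) h hal, add_zero]
  rw [this, Finset.sum_add_distrib, hp.sum_erase, Finset.sum_ite_eq',
    if_pos (Finset.mem_erase.2 ⟨hal, Finset.mem_univ a⟩)]
  ring

theorem step_zero {p : 𝒜 → ℝ} (hp : OpenSimplex p) (α : ℝ) (l : 𝒜) : step α l 0 p = p := by
  ext b
  by_cases hb : b = l
  · subst hb
    simpa using step_single_leader hp α b 0
  · simpa using step_single_leader_of_ne p α hb 0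

/-- The factor `1 - α` bounds the relative decrease of every entry, because no entry exceeds that
of the leading arm. -/
theorem OpenSimplex.step {p : 𝒜 → ℝ} (hp : OpenSimplex p) {α : ℝ} (hα0 : 0 < α) (hα1 : α < 1)
    {l : 𝒜} (hl : l ∈ leaders p) (a : 𝒜) {y : ℝ} (hy0 : 0 ≤ y) (hy1 : y ≤ 1) :
    OpenSimplex (step α l (Pi.single a y) p) := by
  refine ⟨fun b => ?_, sum_step _ _ _ _⟩
  have hαy : α * y < 1 := by nlinarith
  have hαy0 : 0 ≤ α * y := by positivity
  have hl0 := hp.1 l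
  have hb0 := hp.1 b
  by_cases hb : b = l
  · subst hb
    by_cases ha : a = b
    · subst ha
      rw [step_single_leader hp]
      positivity
    · rw [step_single_ne_leader hp α ha]
      nlinarith [mem_leaders.1 hl a, hp.1 a]
  · by_cases ha : a = l
    · subst ha
      rw [step_single_leader_of_ne p α hb]
      have : α * y * p b ^ 2 / p a ≤ α * y * p b := by
        rw [div_le_iff₀ hl0]
        nlinarith [mul_nonneg hαy0 hb0.le, mem_leaders.1 hl b]
      nlinarith
    · by_cases hab : b = a
      · subst hab
        rw [step_single_self_of_ne hp α hb]
        positivity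
      · rw [step_single_of_ne p α hb hab ha]
        exact hb0

/-! ### One-step expectations -/

/-- The reward vector observed when arm `a` is played and the reward is `1` or `0` according to
`b`. -/
def outcome (a : 𝒜) (b : Bool) : 𝒜 → ℝ := Pi.single a (if b then 1 else 0)

/-- The state that follows `p` when arm `i.1` is played, arm `i.2.1` leads and the reward is
`i.2.2`. -/
noncomputable def next (α : ℝ) (p : 𝒜 → ℝ) (i : 𝒜 × 𝒜 × Bool) : 𝒜 → ℝ :=
  step α i.2.1 (outcome i.1 i.2.2) p

/-- The expectation of `f` at the next state, from state `p`. -/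
noncomputable def expectNext (r : 𝒜 → ℝ) (α : ℝ) (f : (𝒜 → ℝ) → ℝ) (p : 𝒜 → ℝ) : ℝ :=
  ∑ i, weight r p i * f (next α p i)

theorem OpenSimplex.next (hp : OpenSimplex p) (hα0 : 0 < α) (hα1 : α < 1)
    {i : 𝒜 × 𝒜 × Bool} (hi : weight r p i ≠ 0) : OpenSimplex (next α p i) := by
  have hl : i.2.1 ∈ leaders p := by
    by_contra h
    simp [weight, leaderWeight_of_notMem h] at hi
  refine hp.step hα0 hα1 hl i.1 ?_ ?_ <;> split_ifs <;> norm_num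

theorem expectNext_eq [Nonempty 𝒜] (hp : OpenSimplex p) (f : (𝒜 → ℝ) → ℝ) :
    expectNext r α f p = f p + ∑ l, leaderWeight p l *
      ∑ a, p a * r a * (f (step α l (Pi.single a 1) p) - f p) := by
  have h1 : ∀ a l, ∑ b, weight r p (a, l, b) * f (next α p (a, l, b)) =
      p a * leaderWeight p l * f p +
        leaderWeight p l * (p a * r a * (f (step α l (Pi.single a 1) p) - f p)) := by
    intro a l
    simp only [Fintype.sum_bool, weight, next, outcome, bernoulliWeight, if_true,
      Bool.false_eq_true, if_false, Pi.single_zero, step_zero hp]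
    ring
  simp only [expectNext, Fintype.sum_prod_type, h1, Finset.sum_add_distrib]
  congr 1
  · simp [← Finset.sum_mul, ← Finset.mul_sum, sum_leaderWeight, hp.2]
  · rw [Finset.sum_comm]
    simp only [Finset.mul_sum]

/-- A bound on the drift that holds for each possible leading arm holds on average. -/
theorem expectNext_le_of_drift [Nonempty 𝒜] (hp : OpenSimplex p) (f : (𝒜 → ℝ) → ℝ) {C : ℝ}
    (h : ∀ l ∈ leaders p, ∑ a, p a * r a * (f (step α l (Pi.single a 1) p) - f p) ≤ C) :
    expectNext r α f p ≤ f p + C := by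
  rw [expectNext_eq hp]
  gcongr
  calc _ ≤ ∑ l, leaderWeight p l * C := by
        refine Finset.sum_le_sum fun l _ => ?_
        by_cases hl : l ∈ leaders p
        · exact mul_le_mul_of_nonneg_left (h l hl) (leaderWeight_nonneg _ _)
        · simp [leaderWeight_of_notMem hl]
    _ = C := by rw [← Finset.sum_mul, sum_leaderWeight, one_mul]

theorem drift_of_ne_leader (hp : OpenSimplex p) {s l : 𝒜} (hs : s ≠ l) (φ : ℝ → ℝ) :
    ∑ a, p a * r a * (φ (step α l (Pi.single a 1) p s) - φ (p s)) =
      p s * r s * (φ (p s + α * p s) - φ (p s)) +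
        p l * r l * (φ (p s - α * p s ^ 2 / p l) - φ (p s)) := by
  rw [Fintype.sum_eq_add s l hs]
  · rw [step_single_self_of_ne hp α hs, step_single_leader_of_ne p α hs, mul_one]
  · rintro a ⟨has, hal⟩
    rw [step_single_of_ne p α hs has.symm hal, sub_self, mul_zero]

theorem drift_leader (hp : OpenSimplex p) (s : 𝒜) (φ : ℝ → ℝ) :
    ∑ a, p a * r a * (φ (step α s (Pi.single a 1) p s) - φ (p s)) =
      p s * r s * (φ (p s + α * (∑ b ∈ Finset.univ.erase s, p b ^ 2) / p s) - φ (p s)) +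
        ∑ a ∈ Finset.univ.erase s, p a * r a * (φ (p s - α * p a) - φ (p s)) := by
  rw [← Finset.add_sum_erase _ _ (Finset.mem_univ s), step_single_leader hp, mul_one]
  congr 1
  refine Finset.sum_congr rfl fun a ha => ?_
  rw [step_single_ne_leader hp α (Finset.ne_of_mem_erase ha), mul_one]

theorem sq_le_mul_sum_sq (hp : OpenSimplex p) (s : 𝒜) :
    (1 - p s) ^ 2 ≤ ((Fintype.card 𝒜 : ℝ) - 1) * ∑ b ∈ Finset.univ.erase s, p b ^ 2 := by
  have h := sq_sum_le_card_mul_sum_sq (s := Finset.univ.erase s) (f := p)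
  rw [hp.sum_erase, Finset.card_erase_of_mem (Finset.mem_univ s), Finset.card_univ,
    Nat.cast_sub (Fintype.card_pos_iff.2 ⟨s⟩), Nat.cast_one] at h
  exact h

/-! ### The Lyapunov function -/

/-- The drift of `x ↦ 1 / x + M (1 - x)` at the probability `x` of the optimal arm, when another
arm, of probability `y` and mean reward `u`, leads. The term `1 / x` decreases on average as long
as `x / y` is small; otherwise `x` is bounded below and the linear term takes over. -/
theorem lyapunov_drift_of_ne {α x y n u v Δ M η K : ℝ} (hα0 : 0 < α) (hα1 : α < 1)
    (hx : 0 < x) (hxy : x ≤ y) (hn : 1 ≤ n * y) (hu1 : u ≤ 1)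
    (huv : u ≤ v - Δ) (hη : η = v / (1 + α) - (v - Δ)) (hη0 : 0 < η)
    (hK : K = α / (1 - α)) (hM0 : 0 ≤ M) (hM : n ^ 2 * (K ^ 2 / (2 * η)) ≤ M * Δ) :
    x * v * (((x + α * x)⁻¹ + M * (1 - (x + α * x))) - (x⁻¹ + M * (1 - x))) +
      y * u * (((x - α * x ^ 2 / y)⁻¹ + M * (1 - (x - α * x ^ 2 / y))) - (x⁻¹ + M * (1 - x)))
      ≤ -(α * (η / 2)) := by
  have hy : 0 < y := hx.trans_le hxy
  obtain ⟨ρ, hρ⟩ : ∃ ρ, ρ = x / y := ⟨_, rfl⟩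
  have hxρ : x = ρ * y := by rw [hρ]; field_simp
  have hρ0 : 0 < ρ := by rw [hρ]; positivity
  have hρ1 : ρ ≤ 1 := by rw [hρ]; exact (div_le_one hy).2 hxy
  have h1 : 0 < 1 - α * ρ := by nlinarith
  have h1' : 0 < 1 - α := by linarith
  have e1 : x * v * (((x + α * x)⁻¹ + M * (1 - (x + α * x))) - (x⁻¹ + M * (1 - x))) =
      -(α * (v / (1 + α))) - M * α * x ^ 2 * v := by
    field_simp
    ring
  have e2 : y * u * (((x - α * x ^ 2 / y)⁻¹ + M * (1 - (x - α * x ^ 2 / y))) -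
      (x⁻¹ + M * (1 - x))) = α * u * (1 + α * ρ / (1 - α * ρ)) + M * α * x ^ 2 * u := by
    have : x - α * x ^ 2 / y = x * (1 - α * ρ) := by rw [hρ]; field_simp
    have h1n := h1.ne'
    rw [this, hxρ]
    field_simp
    linear_combination u * (1 + α * ρ) * mul_inv_cancel₀ h1n
  rw [e1, e2]
  have h2 : α * ρ / (1 - α * ρ) ≤ K * ρ := by
    rw [hK, div_mul_eq_mul_div]
    apply div_le_div_of_nonneg_left (by positivity) h1'
    nlinarith
  have hK0 : 0 ≤ K := by rw [hK]; positivity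
  have h3 : u * (1 + α * ρ / (1 - α * ρ)) ≤ (v - Δ) + K * ρ := by
    have : u * (α * ρ / (1 - α * ρ)) ≤ 1 * (K * ρ) := by
      apply mul_le_mul hu1 h2 (by positivity) (by positivity)
    linarith
  -- Young's inequality; the constant `M` is chosen so that the square is absorbed.
  have h4 : K * ρ ≤ η / 2 + K ^ 2 / (2 * η) * ρ ^ 2 := by
    have : η / 2 + K ^ 2 / (2 * η) * ρ ^ 2 - K * ρ = (K * ρ - η) ^ 2 / (2 * η) := by
      field_simp
      ring
    have h5 : 0 ≤ (K * ρ - η) ^ 2 / (2 * η) := by positivity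
    linarith
  have h5 : K ^ 2 / (2 * η) * ρ ^ 2 ≤ M * (v - u) * x ^ 2 := by
    have h6 : ρ ≤ n * x := by rw [hxρ]; nlinarith
    calc K ^ 2 / (2 * η) * ρ ^ 2 ≤ K ^ 2 / (2 * η) * (n * x) ^ 2 := by gcongr
      _ = n ^ 2 * (K ^ 2 / (2 * η)) * x ^ 2 := by ring
      _ ≤ M * Δ * x ^ 2 := by gcongr
      _ ≤ M * (v - u) * x ^ 2 := by gcongr; linarith
  have h7 : u * (1 + α * ρ / (1 - α * ρ)) - v / (1 + α) - M * (v - u) * x ^ 2 ≤ -(η / 2) := by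
    rw [hη] at h4 ⊢
    rw [hη] at h5
    linarith
  nlinarith [mul_le_mul_of_nonneg_left h7 hα0.le]

/-- The drift of `x ↦ 1 / x + M (1 - x)` when the optimal arm leads: the drift of `1 / x` is at
most of order `∑ p_a²`, and the linear term compensates it. -/
theorem lyapunov_drift_leader {s : 𝒜} {Δ M : ℝ} (hp : OpenSimplex p) (hs : s ∈ leaders p)
    (hα0 : 0 < α) (hα1 : α < 1) (hr0 : ∀ a, 0 ≤ r a) (hr1 : ∀ a, r a ≤ 1)
    (hr : ∀ a, a ≠ s → r a ≤ r s - Δ) (hM0 : 0 ≤ M)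
    (hM : (Fintype.card 𝒜 : ℝ) ^ 2 / (1 - α) + 1 ≤ M * Δ) :
    ∑ a, p a * r a * (((step α s (Pi.single a 1) p s)⁻¹ +
      M * (1 - step α s (Pi.single a 1) p s)) - ((p s)⁻¹ + M * (1 - p s))) ≤
      -(α * ∑ b ∈ Finset.univ.erase s, p b ^ 2) := by
  rw [drift_leader hp s (fun x => x⁻¹ + M * (1 - x))]
  set S := ∑ b ∈ Finset.univ.erase s, p b ^ 2 with hS
  set n : ℝ := (Fintype.card 𝒜 : ℝ)
  have hx := hp.1 s
  have hS0 : 0 ≤ S := Finset.sum_nonneg fun b _ => sq_nonneg _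
  have h1' : 0 < 1 - α := by linarith
  have hn : (p s)⁻¹ ≤ n := by
    rw [inv_le_iff_one_le_mul₀ hx]
    exact hp.one_le_card_mul hs
  have e1 : p s * r s * (((p s + α * S / p s)⁻¹ + M * (1 - (p s + α * S / p s))) -
      ((p s)⁻¹ + M * (1 - p s))) ≤ - (M * α * S * r s) := by
    have h : (p s + α * S / p s)⁻¹ ≤ (p s)⁻¹ := by
      apply inv_anti₀ hx
      have : 0 ≤ α * S / p s := by positivity
      linarith
    have h2 : p s * r s * (M * (α * S / p s)) = M * α * S * r s := by
      field_simp
    have h3 : 0 ≤ p s * r s * ((p s)⁻¹ - (p s + α * S / p s)⁻¹) :=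
      mul_nonneg (mul_nonneg hx.le (hr0 s)) (by linarith)
    nlinarith
  have e2 : ∀ a ∈ Finset.univ.erase s, p a * r a * (((p s - α * p a)⁻¹ +
      M * (1 - (p s - α * p a))) - ((p s)⁻¹ + M * (1 - p s))) ≤
      (α * (n ^ 2 / (1 - α)) + M * α * (r s - Δ)) * p a ^ 2 := by
    intro a ha
    have ha0 := hp.1 a
    have hle := mem_leaders.1 hs a
    have h4 : (1 - α) * p s ≤ p s - α * p a := by nlinarith
    have h5 : 0 < p s - α * p a := by nlinarith
    have h6 : (p s - α * p a)⁻¹ - (p s)⁻¹ ≤ α * p a * (n ^ 2 / (1 - α)) := by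
      have : (p s - α * p a)⁻¹ - (p s)⁻¹ = α * p a * ((p s)⁻¹ * (p s - α * p a)⁻¹) := by
        field_simp
        ring
      rw [this]
      have h7 : (p s - α * p a)⁻¹ ≤ (1 - α)⁻¹ * (p s)⁻¹ := by
        rw [← mul_inv]
        exact inv_anti₀ (by positivity) h4
      have h8 : (p s)⁻¹ * (p s - α * p a)⁻¹ ≤ n * ((1 - α)⁻¹ * n) := by
        have : (0:ℝ) < n := (inv_pos.2 hx).trans_le hn
        refine mul_le_mul hn (h7.trans ?_) (by positivity) (by positivity)
        gcongr
      calc _ ≤ α * p a * (n * ((1 - α)⁻¹ * n)) := by gcongr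
        _ = _ := by ring
    have h9 : p a * r a * ((p s - α * p a)⁻¹ - (p s)⁻¹) ≤
        p a * 1 * (α * p a * (n ^ 2 / (1 - α))) := by
      have h10 : 0 ≤ (p s - α * p a)⁻¹ - (p s)⁻¹ := by
        have : (p s)⁻¹ ≤ (p s - α * p a)⁻¹ := inv_anti₀ h5 (by nlinarith)
        linarith
      refine mul_le_mul ?_ h6 h10 (by linarith)
      have := hr1 a
      gcongr
    have h11 : M * α * p a ^ 2 * r a ≤ M * α * p a ^ 2 * (r s - Δ) := by
      have := hr a (Finset.ne_of_mem_erase ha)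
      gcongr
    nlinarith
  have e3 := Finset.sum_le_sum e2
  rw [← Finset.mul_sum, ← hS] at e3
  have e4 : (α * S) * (n ^ 2 / (1 - α) + 1) ≤ (α * S) * (M * Δ) := by gcongr
  nlinarith

/-- The Lyapunov function `1 / x + M (1 - x)` of the probability `x` of the arm `s`. -/
noncomputable def lyapunov (M : ℝ) (s : 𝒜) (p : 𝒜 → ℝ) : ℝ := (p s)⁻¹ + M * (1 - p s)

open Classical in
/-- For a large constant `M` the Lyapunov function decreases on average in every state, and by at
least a fixed amount in the states where the optimal arm has probability at most `1 / 2`. -/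
theorem exists_lyapunov [Nontrivial 𝒜] {s : 𝒜} {Δ : ℝ} (hα0 : 0 < α) (hα1 : α < 1)
    (hr0 : ∀ a, 0 ≤ r a) (hr1 : ∀ a, r a ≤ 1) (hΔ : 0 < Δ)
    (hr : ∀ a, a ≠ s → r a ≤ r s - Δ) (hrα : (1 + α) * (r s - Δ) < r s) :
    ∃ M η : ℝ, 0 ≤ M ∧ 0 < η ∧ ∀ p, OpenSimplex p →
      expectNext r α (lyapunov M s) p + (if p s ≤ 1 / 2 then η else 0) ≤ lyapunov M s p := by
  obtain ⟨η, hη⟩ : ∃ η, η = r s / (1 + α) - (r s - Δ) := ⟨_, rfl⟩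
  obtain ⟨K, hK⟩ : ∃ K, K = α / (1 - α) := ⟨_, rfl⟩
  obtain ⟨n, hn⟩ : ∃ n, n = (Fintype.card 𝒜 : ℝ) := ⟨_, rfl⟩
  have h1' : 0 < 1 - α := by linarith
  have hn1 : 1 < n := by
    rw [hn]
    exact_mod_cast Fintype.one_lt_card
  have hη0 : 0 < η := by
    rw [hη, sub_pos, lt_div_iff₀ (by linarith)]
    linarith
  obtain ⟨M, hM⟩ : ∃ M, M = (n ^ 2 * (K ^ 2 / (2 * η)) + (n ^ 2 / (1 - α) + 1)) / Δ := ⟨_, rfl⟩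
  have hM0 : 0 ≤ M := by rw [hM]; positivity
  have hMΔ : M * Δ = n ^ 2 * (K ^ 2 / (2 * η)) + (n ^ 2 / (1 - α) + 1) := by
    rw [hM]
    field_simp
  have hA : 0 ≤ n ^ 2 * (K ^ 2 / (2 * η)) := by positivity
  have hB : 0 ≤ n ^ 2 / (1 - α) + 1 := by positivity
  have hmin : 0 < min (α * (η / 2)) (α / (4 * n)) := lt_min (by positivity) (by positivity)
  refine ⟨M, min (α * (η / 2)) (α / (4 * n)), hM0, hmin, fun p hp => ?_⟩
  have key : expectNext r α (lyapunov M s) p ≤ lyapunov M s p +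
      -(if p s ≤ 1 / 2 then min (α * (η / 2)) (α / (4 * n)) else 0) := by
    refine expectNext_le_of_drift hp _ fun l hl => ?_
    by_cases hls : s = l
    · subst hls
      refine (lyapunov_drift_leader hp hl hα0 hα1 hr0 hr1 hr hM0 ?_).trans (neg_le_neg ?_)
      · rw [← hn]
        linarith
      · split_ifs with h
        · refine (min_le_right _ _).trans ?_
          have h2 := sq_le_mul_sum_sq hp s
          rw [← hn] at h2
          set S := ∑ b ∈ Finset.univ.erase s, p b ^ 2
          have hS0 : 0 ≤ S := Finset.sum_nonneg fun b _ => sq_nonneg _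
          have h3 : 1 / 4 ≤ n * S := by nlinarith
          rw [div_le_iff₀ (by positivity)]
          nlinarith
        · exact mul_nonneg hα0.le (Finset.sum_nonneg fun b _ => sq_nonneg _)
    · have h2 := drift_of_ne_leader (r := r) (α := α) hp hls (fun x => x⁻¹ + M * (1 - x))
      refine (h2.trans_le (lyapunov_drift_of_ne (n := n) (Δ := Δ) (η := η) (K := K) hα0 hα1
        (hp.1 s) (mem_leaders.1 hl s) ?_ (hr1 l) (hr l (Ne.symm hls)) hη
        hη0 hK hM0 (by linarith))).trans (neg_le_neg ?_)
      · rw [hn]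
        exact hp.one_le_card_mul hl
      · split_ifs with h
        · exact min_le_left _ _
        · positivity
  linarith

end

section

variable {𝒜 : Type*} {r : 𝒜 → ℝ} {α : ℝ} {p : 𝒜 → ℝ}

/-! ### The truncated suboptimality and the regret potential -/

/-- The probability `1 - p s` of the arms other than `s`, truncated at `1 / 2`. -/
noncomputable def truncSubopt (s : 𝒜) (p : 𝒜 → ℝ) : ℝ := min (1 - p s) (1 / 2)

theorem truncSubopt_le_half (s : 𝒜) (p : 𝒜 → ℝ) : truncSubopt s p ≤ 1 / 2 := min_le_right _ _

theorem truncSubopt_of_lt {s : 𝒜} (h : 1 / 2 < p s) : truncSubopt s p = 1 - p s :=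
  min_eq_left (by linarith)

theorem truncSubopt_of_le {s : 𝒜} (h : p s ≤ 1 / 2) : truncSubopt s p = 1 / 2 :=
  min_eq_right (by linarith)

variable [Fintype 𝒜]

theorem truncSubopt_nonneg (hp : OpenSimplex p) (s : 𝒜) : 0 ≤ truncSubopt s p :=
  le_min (by linarith [hp.le_one s]) (by norm_num)

variable [DecidableEq 𝒜]

theorem expectNext_mono (hα0 : 0 < α) (hα1 : α < 1) (hr0 : ∀ a, 0 ≤ r a) (hr1 : ∀ a, r a ≤ 1)
    (hp : OpenSimplex p) {f g : (𝒜 → ℝ) → ℝ} (h : ∀ q, OpenSimplex q → f q ≤ g q) :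
    expectNext r α f p ≤ expectNext r α g p := by
  refine Finset.sum_le_sum fun i _ => ?_
  by_cases hi : weight r p i = 0
  · simp [hi]
  · exact mul_le_mul_of_nonneg_left (h _ (hp.next hα0 hα1 hi))
      (weight_nonneg hr0 hr1 (fun a => (hp.1 a).le) i)

theorem expectNext_const_add_mul [Nonempty 𝒜] (hp : OpenSimplex p) (A B : ℝ)
    (f : (𝒜 → ℝ) → ℝ) :
    expectNext r α (fun q => A + B * f q) p = A + B * expectNext r α f p := by
  simp only [expectNext, mul_add, Finset.sum_add_distrib, ← Finset.sum_mul, sum_weight hp.2,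
    one_mul, Finset.mul_sum]
  congr 1
  exact Finset.sum_congr rfl fun i _ => by ring

theorem expectNext_one_sub_le [Nontrivial 𝒜] {s : 𝒜} {Δ : ℝ} (hα0 : 0 < α)
    (hΔ : 0 < Δ) (hr : ∀ a, a ≠ s → r a ≤ r s - Δ) (hp : OpenSimplex p) (hs : 1 / 2 < p s) :
    expectNext r α (fun q => 1 - q s) p ≤
      (1 - p s) - α * Δ / ((Fintype.card 𝒜 : ℝ) - 1) * (1 - p s) ^ 2 := by
  rw [sub_eq_add_neg (1 - p s)]
  refine expectNext_le_of_drift hp (fun q => 1 - q s) fun l hl => ?_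
  obtain rfl : l = s := by
    by_contra hls
    have h1 := Finset.single_le_sum (f := p) (s := Finset.univ.erase s)
      (fun b _ => (hp.1 b).le) (Finset.mem_erase.2 ⟨hls, Finset.mem_univ l⟩)
    rw [hp.sum_erase] at h1
    linarith [mem_leaders.1 hl s]
  rw [drift_leader hp l (fun x => 1 - x)]
  have h1 := sq_le_mul_sum_sq hp l
  have hn : (1 : ℝ) < Fintype.card 𝒜 := by exact_mod_cast Fintype.one_lt_card
  set S := ∑ b ∈ Finset.univ.erase l, p b ^ 2 with hS
  have hx := (hp.1 l).ne'
  have e1 : p l * r l * (1 - (p l + α * S / p l) - (1 - p l)) = - (α * S * r l) := by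
    field_simp
    ring
  have e2 : ∑ a ∈ Finset.univ.erase l, p a * r a * (1 - (p l - α * p a) - (1 - p l)) ≤
      ∑ a ∈ Finset.univ.erase l, α * (r l - Δ) * p a ^ 2 := by
    refine Finset.sum_le_sum fun a ha => ?_
    have h2 := hr a (Finset.ne_of_mem_erase ha)
    have h3 : α * p a ^ 2 * r a ≤ α * p a ^ 2 * (r l - Δ) := by gcongr
    linarith
  rw [← Finset.mul_sum, ← hS] at e2
  have e3 : α * Δ / ((Fintype.card 𝒜 : ℝ) - 1) * (1 - p l) ^ 2 ≤ α * Δ * S := by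
    rw [div_mul_eq_mul_div, div_le_iff₀ (by linarith)]
    nlinarith [mul_le_mul_of_nonneg_left h1 (mul_pos hα0 hΔ).le]
  rw [e1]
  linarith

/-- Truncation makes the suboptimality a supermartingale: where the arm `s` has probability at most
`1 / 2` the truncated value is maximal. -/
theorem expectNext_truncSubopt_le [Nontrivial 𝒜] {s : 𝒜} {Δ : ℝ} (hα0 : 0 < α) (hα1 : α < 1)
    (hr0 : ∀ a, 0 ≤ r a) (hr1 : ∀ a, r a ≤ 1)
    (hΔ : 0 < Δ) (hr : ∀ a, a ≠ s → r a ≤ r s - Δ) (hp : OpenSimplex p) :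
    expectNext r α (truncSubopt s) p + (if 1 / 2 < p s then
      α * Δ / ((Fintype.card 𝒜 : ℝ) - 1) * truncSubopt s p ^ 2 else 0) ≤ truncSubopt s p := by
  split_ifs with h
  · have h1 := expectNext_one_sub_le hα0 hΔ hr hp h
    have h2 := expectNext_mono (f := truncSubopt s) (g := fun q => 1 - q s) hα0 hα1 hr0 hr1 hp
      fun q _ => min_le_left _ _
    rw [truncSubopt_of_lt h]
    linarith
  · have h2 := expectNext_mono (f := truncSubopt s) (g := fun _ => 1 / 2 + 0 * 0) hα0 hα1 hr0 hr1
      hp fun q _ => by simpa using truncSubopt_le_half s q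
    rw [expectNext_const_add_mul hp (1 / 2) 0 (fun _ => 0)] at h2
    rw [truncSubopt_of_le (not_lt.1 h)]
    linarith

theorem div_one_add_le_tangent {d w m : ℝ} (hd : 0 ≤ d) (hw : 0 ≤ w) (hm : 0 ≤ m) :
    w / (1 + d * w) ≤ m / (1 + d * m) + (w - m) * ((1 + d * m) ^ 2)⁻¹ := by
  have h1 : 0 < 1 + d * w := by positivity
  have h2 : 0 < 1 + d * m := by positivity
  have : m / (1 + d * m) + (w - m) * ((1 + d * m) ^ 2)⁻¹ - w / (1 + d * w) =
      d * (w - m) ^ 2 / ((1 + d * m) ^ 2 * (1 + d * w)) := by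
    field_simp
    ring
  have h3 : 0 ≤ d * (w - m) ^ 2 / ((1 + d * m) ^ 2 * (1 + d * w)) := by positivity
  linarith

theorem div_one_add_mono {d w m : ℝ} (hd : 0 ≤ d) (hw : 0 ≤ w) (hwm : w ≤ m) :
    w / (1 + d * w) ≤ m / (1 + d * m) := by
  have hm := hw.trans hwm
  rw [div_le_div_iff₀ (by positivity) (by positivity)]
  linarith

/-- The iterates of `w ↦ w - c w²` decrease at least as fast as `w / (1 + c i w)`. -/
theorem div_one_add_sub_sq_le {c w : ℝ} (hc : 0 ≤ c) (hw : 0 ≤ w) (hcw : c * w ≤ 1) (i : ℕ) :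
    (w - c * w ^ 2) / (1 + c * i * (w - c * w ^ 2)) ≤ w / (1 + c * (i + 1 : ℕ) * w) := by
  have h0 : 0 ≤ w - c * w ^ 2 := by nlinarith
  rw [div_le_div_iff₀ (by positivity) (by positivity)]
  push_cast
  have : 0 ≤ c ^ 2 * w ^ 3 := by positivity
  nlinarith

/-- `∑_{i < j} w / (1 + c i w)`: a concave bound on the sum of the first `j` values of a process
that starts from `w` and satisfies `E[w'] ≤ w - c w²`. -/
noncomputable def potential (c : ℝ) (j : ℕ) (w : ℝ) : ℝ :=
  ∑ i ∈ Finset.range j, w / (1 + c * i * w)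

theorem potential_nonneg {c w : ℝ} (hc : 0 ≤ c) (hw : 0 ≤ w) (j : ℕ) : 0 ≤ potential c j w :=
  Finset.sum_nonneg fun i _ => by positivity

theorem potential_mono {c w m : ℝ} (hc : 0 ≤ c) (hw : 0 ≤ w) (hwm : w ≤ m) (j : ℕ) :
    potential c j w ≤ potential c j m :=
  Finset.sum_le_sum fun i _ => div_one_add_mono (by positivity) hw hwm

theorem potential_le_succ {c w : ℝ} (hc : 0 ≤ c) (hw : 0 ≤ w) (j : ℕ) :
    potential c j w ≤ potential c (j + 1) w := by
  rw [potential, potential, Finset.sum_range_succ]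
  have : 0 ≤ w / (1 + c * j * w) := by positivity
  linarith

theorem add_potential_sub_sq_le {c w : ℝ} (hc : 0 ≤ c) (hw : 0 ≤ w) (hcw : c * w ≤ 1) (j : ℕ) :
    potential c j (w - c * w ^ 2) + w ≤ potential c (j + 1) w := by
  rw [potential, potential, Finset.sum_range_succ']
  simp only [Nat.cast_zero, mul_zero, zero_mul, add_zero, div_one]
  exact add_le_add_left (Finset.sum_le_sum fun i _ => div_one_add_sub_sq_le hc hw hcw i) w

/-- Jensen's inequality for the concave function `potential c j`. -/
theorem expectNext_potential_le [Nonempty 𝒜] {s : 𝒜} {c m : ℝ} (hα0 : 0 < α) (hα1 : α < 1)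
    (hr0 : ∀ a, 0 ≤ r a) (hr1 : ∀ a, r a ≤ 1) (hp : OpenSimplex p) (hc : 0 ≤ c)
    (hm : expectNext r α (truncSubopt s) p ≤ m) (j : ℕ) :
    expectNext r α (fun q => potential c j (truncSubopt s q)) p ≤ potential c j m := by
  set e := expectNext r α (truncSubopt s) p with he
  have he0 : 0 ≤ e := by
    have h := expectNext_mono (f := fun _ => 0 + 0 * 0) (g := truncSubopt s) hα0 hα1 hr0 hr1 hp
      fun q hq => by simpa using truncSubopt_nonneg hq s
    rw [expectNext_const_add_mul hp 0 0 (fun _ => 0)] at h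
    linarith
  refine le_trans ?_ (potential_mono hc he0 hm j)
  have h1 : expectNext r α (fun q => potential c j (truncSubopt s q)) p =
      ∑ i ∈ Finset.range j, expectNext r α
        (fun q => truncSubopt s q / (1 + c * i * truncSubopt s q)) p := by
    simp only [expectNext, potential, Finset.mul_sum]
    exact Finset.sum_comm
  rw [h1]
  refine Finset.sum_le_sum fun i _ => ?_
  have hci : 0 ≤ c * i := by positivity
  set B := ((1 + c * i * e) ^ 2)⁻¹
  calc _ ≤ expectNext r α (fun q => (e / (1 + c * i * e) - B * e) + B * truncSubopt s q) p := by
        refine expectNext_mono hα0 hα1 hr0 hr1 hp fun q hq => ?_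
        linarith [div_one_add_le_tangent hci (truncSubopt_nonneg hq s) he0]
    _ = e / (1 + c * i * e) := by
        rw [expectNext_const_add_mul hp, ← he]
        ring

/-- The potential with one unit of budget less pays for the suboptimality of the current state, if
that is a state in which the arm `s` has probability above `1 / 2`. -/
theorem expectNext_potential_add_le [Nontrivial 𝒜] {s : 𝒜} {Δ c : ℝ} (hα0 : 0 < α)
    (hα1 : α < 1) (hr0 : ∀ a, 0 ≤ r a) (hr1 : ∀ a, r a ≤ 1)
    (hΔ : 0 < Δ) (hr : ∀ a, a ≠ s → r a ≤ r s - Δ)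
    (hc : c = α * Δ / ((Fintype.card 𝒜 : ℝ) - 1)) (hc0 : 0 ≤ c) (hc1 : c ≤ 1)
    (hp : OpenSimplex p) (j : ℕ) :
    expectNext r α (fun q => potential c j (truncSubopt s q)) p +
      (if 1 / 2 < p s then 1 - p s else 0) ≤ potential c (j + 1) (truncSubopt s p) := by
  have h1 := expectNext_truncSubopt_le hα0 hα1 hr0 hr1 hΔ hr hp
  have h0 := truncSubopt_nonneg hp s
  have hh := truncSubopt_le_half s p
  split_ifs at h1 ⊢ with h
  · rw [← truncSubopt_of_lt h]
    rw [← hc] at h1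
    have h2 := expectNext_potential_le (c := c) hα0 hα1 hr0 hr1 hp hc0 (le_sub_iff_add_le.2 h1) j
    linarith [add_potential_sub_sq_le hc0 h0 (by nlinarith) j]
  · rw [add_zero] at h1 ⊢
    exact (expectNext_potential_le hα0 hα1 hr0 hr1 hp hc0 h1 j).trans (potential_le_succ hc0 h0 j)

theorem potential_half_le {c : ℝ} (hc0 : 0 < c) (hc1 : c ≤ 1) {T : ℕ} (hT : 1 ≤ T) :
    potential c T (1 / 2) ≤ 1 / 2 + Real.log T / c := by
  induction T, hT using Nat.le_induction with
  | base => simp [potential]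
  | succ n hn ih =>
    rw [potential, Finset.sum_range_succ, ← potential]
    have hn0 : (0 : ℝ) < n := by exact_mod_cast hn
    have h1 : (1 / 2 : ℝ) / (1 + c * n * (1 / 2)) ≤ (1 / ((n : ℝ) + 1)) / c := by
      have h : (1 / 2 : ℝ) / (1 + c * n * (1 / 2)) = 1 / (2 + c * n) := by field_simp
      rw [h, div_div]
      exact one_div_le_one_div_of_le (by positivity) (by linarith)
    have h2 : 1 / ((n : ℝ) + 1) ≤ Real.log (n + 1) - Real.log n := by
      have h := Real.one_sub_inv_le_log_of_pos (x := ((n : ℝ) + 1) / n) (by positivity)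
      rw [Real.log_div (by positivity) (by positivity)] at h
      refine le_trans (le_of_eq ?_) h
      field_simp
      ring
    have h3 : (1 / ((n : ℝ) + 1)) / c ≤ (Real.log (n + 1) - Real.log n) / c := by gcongr
    push_cast
    rw [sub_div] at h3
    linarith

theorem potential_half_le_log {n αΔ c : ℝ} (hn : 1 < n) (hαΔ0 : 0 < αΔ) (hαΔ1 : αΔ ≤ 1)
    (hc : c = αΔ / (n - 1)) (hc1 : c ≤ 1) {T : ℕ} (hT : 2 ≤ T) :
    potential c T (1 / 2) ≤ n / αΔ * Real.log T := by
  have hn1 : 0 < n - 1 := by linarith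
  have hc0 : 0 < c := by rw [hc]; positivity
  refine (potential_half_le hc0 hc1 (by omega)).trans ?_
  have h1 : 1 / 2 ≤ Real.log T := by
    have h2 : Real.log 2 ≤ Real.log T :=
      Real.log_le_log (by norm_num) (by exact_mod_cast hT)
    linarith [Real.log_two_gt_d9]
  have h3 : n / αΔ * Real.log T - Real.log T / c = Real.log T / αΔ := by
    rw [hc]
    field_simp
    ring
  have h4 : Real.log T ≤ Real.log T / αΔ := le_div_self (by linarith) hαΔ0 hαΔ1
  linarith

end

section

/-! ### Measurability -/

variable {𝒜 : Type*}

theorem measurable_truncSubopt (s : 𝒜) :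
    Measurable (truncSubopt s : (𝒜 → ℝ) → ℝ) :=
  (measurable_const.sub (measurable_pi_apply s)).min measurable_const

theorem measurableSet_half_lt (s : 𝒜) :
    MeasurableSet {p : 𝒜 → ℝ | 1 / 2 < p s} :=
  measurableSet_lt measurable_const (measurable_pi_apply s)

variable [Fintype 𝒜]

theorem measurableSet_mem_leaders (l : 𝒜) : MeasurableSet {p : 𝒜 → ℝ | l ∈ leaders p} := by
  simp only [mem_leaders, Set.ofPred_forall]
  exact MeasurableSet.iInter fun b =>
    measurableSet_le (measurable_pi_apply b) (measurable_pi_apply l)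

theorem measurable_leaderWeight (l : 𝒜) : Measurable fun p : 𝒜 → ℝ => leaderWeight p l := by
  classical
  have h : ∀ p : 𝒜 → ℝ, ((leaders p).card : ℝ) = ∑ a, if a ∈ leaders p then 1 else 0 := by
    intro p
    simp
  simp only [leaderWeight, h]
  refine Measurable.ite (measurableSet_mem_leaders l) (Measurable.inv ?_) measurable_const
  exact Finset.measurable_sum _ fun a _ =>
    Measurable.ite (measurableSet_mem_leaders a) measurable_const measurable_const

theorem measurable_weight (r : 𝒜 → ℝ) (i : 𝒜 × 𝒜 × Bool) :
    Measurable fun p : 𝒜 → ℝ => weight r p i :=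
  ((measurable_pi_apply _).mul (measurable_leaderWeight _)).mul_const _

theorem measurableSet_stdSimplex : MeasurableSet (stdSimplex ℝ 𝒜) :=
  (isClosed_stdSimplex ℝ 𝒜).measurableSet

variable [DecidableEq 𝒜]

theorem measurable_step (α : ℝ) (l : 𝒜) :
    Measurable fun x : (𝒜 → ℝ) × (𝒜 → ℝ) => step α l x.1 x.2 := by
  have h : ∀ b, Measurable fun x : (𝒜 → ℝ) × (𝒜 → ℝ) => stepOther α l x.1 x.2 b := by
    intro b
    unfold stepOther
    fun_prop
  refine measurable_pi_lambda _ fun a => ?_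
  unfold step
  split_ifs
  · exact measurable_const.sub (Finset.measurable_sum _ fun b _ => h b)
  · exact h a

theorem measurable_next (α : ℝ) (i : 𝒜 × 𝒜 × Bool) :
    Measurable fun p : 𝒜 → ℝ => next α p i :=
  (measurable_step α i.2.1).comp (measurable_const.prodMk measurable_id)

/-! ### The transition kernel -/

open Classical in
/-- The transition kernel of SAMBA. Off the simplex, where the weights are not those of a
probability distribution, the state is kept. -/
noncomputable def transition (r : 𝒜 → ℝ) (α : ℝ) : Kernel (𝒜 → ℝ) (𝒜 → ℝ) where
  toFun p := if p ∈ stdSimplex ℝ 𝒜 then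
    ∑ i, ENNReal.ofReal (weight r p i) • Measure.dirac (next α p i) else Measure.dirac p
  measurable' := by
    refine Measurable.ite measurableSet_stdSimplex ?_ Measure.measurable_dirac
    refine Measure.measurable_of_measurable_coe _ fun B hB => ?_
    simp only [Measure.finsetSum_apply, Measure.smul_apply, smul_eq_mul,
      Measure.dirac_apply' _ hB]
    refine Finset.measurable_sum _ fun i _ => (measurable_weight r i).ennreal_ofReal.mul ?_
    exact (measurable_const.indicator hB).comp (measurable_next α i)

variable {r : 𝒜 → ℝ} {α : ℝ}

theorem transition_apply {p : 𝒜 → ℝ} (hp : p ∈ stdSimplex ℝ 𝒜) {B : Set (𝒜 → ℝ)}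
    (hB : MeasurableSet B) : transition r α p B =
      ∑ i, ENNReal.ofReal (weight r p i) * B.indicator 1 (next α p i) := by
  have : transition r α p =
      ∑ i, ENNReal.ofReal (weight r p i) • Measure.dirac (next α p i) := if_pos hp
  rw [this]
  simp [Measure.finsetSum_apply, Measure.dirac_apply' _ hB]

theorem isMarkovKernel_transition [Nonempty 𝒜] (hr0 : ∀ a, 0 ≤ r a) (hr1 : ∀ a, r a ≤ 1) :
    IsMarkovKernel (transition r α) := by
  refine ⟨fun p => ⟨?_⟩⟩
  by_cases hp : p ∈ stdSimplex ℝ 𝒜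
  · rw [transition_apply hp MeasurableSet.univ]
    simp only [Set.indicator_univ, Pi.one_apply, mul_one]
    rw [← ENNReal.ofReal_sum_of_nonneg fun i _ => weight_nonneg hr0 hr1 hp.1 i,
      sum_weight hp.2, ENNReal.ofReal_one]
  · have : transition r α p = Measure.dirac p := if_neg hp
    rw [this]
    exact measure_univ

/-! ### The history -/

set_option linter.unusedSectionVars false

variable {Ω : Type*} {p₀ : 𝒜 → ℝ} {R : ℕ → 𝒜 → Ω → ℝ} {arm lead : ℕ → Ω → 𝒜}

/-- The outcome of time `t` is `i`: arm `i.1` is played, arm `i.2.1` leads, and the reward of the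
arm played is given by `i.2.2`. -/
def branch (R : ℕ → 𝒜 → Ω → ℝ) (arm lead : ℕ → Ω → 𝒜) (t : ℕ)
    (i : 𝒜 × 𝒜 × Bool) : Set Ω :=
  {ω | arm t ω = i.1 ∧ lead t ω = i.2.1} ∩ {ω | R t i.1 ω = if i.2.2 then 1 else 0}

theorem pairwise_disjoint_branch (R : ℕ → 𝒜 → Ω → ℝ) (arm lead : ℕ → Ω → 𝒜) (t : ℕ) :
    Pairwise (Function.onFun Disjoint (branch R arm lead t)) := by
  rintro ⟨a, l, b⟩ ⟨a', l', b'⟩ hne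
  rw [Function.onFun, Set.disjoint_left]
  rintro ω ⟨⟨h1, h2⟩, h3⟩ ⟨⟨h1', h2'⟩, h3'⟩
  simp only [Set.mem_ofPred_eq] at *
  subst h1 h2 h1' h2'
  rw [h3] at h3'
  cases b <;> cases b' <;> simp at h3' hne

theorem prob_succ_of_mem_branch {t : ℕ} {i : 𝒜 × 𝒜 × Bool} {ω : Ω}
    (hω : ω ∈ branch R arm lead t i) :
    prob α p₀ R arm lead (t + 1) ω = next α (prob α p₀ R arm lead t ω) i := by
  obtain ⟨⟨h1, h2⟩, h3⟩ := hω
  have : observed R arm t ω = outcome i.1 i.2.2 := by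
    ext b
    by_cases hb : b = i.1
    · subst hb
      simpa [observed, h1, outcome] using h3
    · simp [observed, h1, outcome, Ne.symm hb]
  rw [prob, this, h2, next]

variable [MeasurableSpace 𝒜] [MeasurableSingletonClass 𝒜] [mΩ : MeasurableSpace Ω]
  {P : Measure Ω} [IsProbabilityMeasure P]

theorem history_mono (R : ℕ → 𝒜 → Ω → ℝ) (arm lead : ℕ → Ω → 𝒜) :
    Monotone (history R arm lead) := by
  intro t u htu
  refine iSup_le fun s => ?_
  exact le_iSup (fun s : Fin u => MeasurableSpace.comap
    (fun ω => (arm s ω, lead s ω, observed R arm s ω)) inferInstance)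
    (⟨s, s.2.trans_le htu⟩ : Fin u)

theorem comap_le_history (R : ℕ → 𝒜 → Ω → ℝ) (arm lead : ℕ → Ω → 𝒜) {s t : ℕ} (hst : s < t) :
    MeasurableSpace.comap (fun ω => (arm s ω, lead s ω, observed R arm s ω)) inferInstance ≤
      history R arm lead t :=
  le_iSup (fun s : Fin t => MeasurableSpace.comap
    (fun ω => (arm s ω, lead s ω, observed R arm s ω)) inferInstance) (⟨s, hst⟩ : Fin t)

theorem measurable_prob (α : ℝ) (p₀ : 𝒜 → ℝ) (R : ℕ → 𝒜 → Ω → ℝ) (arm lead : ℕ → Ω → 𝒜) (t : ℕ) :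
    Measurable[history R arm lead t] (prob α p₀ R arm lead t) := by
  induction t with
  | zero => exact measurable_const
  | succ t ih =>
    have h1 : Measurable[history R arm lead (t + 1)]
        (fun ω => (arm t ω, lead t ω, observed R arm t ω)) :=
      (comap_measurable _).mono (comap_le_history R arm lead t.lt_succ_self) le_rfl
    have h2 := ih.mono (history_mono R arm lead t.le_succ) le_rfl
    have h3 : Measurable fun x : 𝒜 × (𝒜 → ℝ) × (𝒜 → ℝ) => step α x.1 x.2.1 x.2.2 :=
      measurable_from_prod_countable_right fun l => measurable_step α l
    have h4 := (measurable_snd.comp h1)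
    exact h3.comp ((measurable_fst.comp h4).prodMk ((measurable_snd.comp h4).prodMk h2))

namespace IsRun

variable (hrun : IsRun P r α p₀ R arm lead)
include hrun

theorem measurable_observed (t : ℕ) : Measurable (observed R arm t) := by
  refine measurable_pi_lambda _ fun a => Measurable.mul ?_ (hrun.measurable_reward t a)
  exact Measurable.ite (hrun.measurable_arm t (measurableSet_singleton a)) measurable_const
    measurable_const

theorem history_le (t : ℕ) : history R arm lead t ≤ mΩ :=
  iSup_le fun s => ((hrun.measurable_arm s).prodMk
    ((hrun.measurable_lead s).prodMk (hrun.measurable_observed s))).comap_le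

theorem measurable_prob (t : ℕ) : Measurable (prob α p₀ R arm lead t) :=
  (Samba.measurable_prob α p₀ R arm lead t).mono (hrun.history_le t) le_rfl

theorem mean_nonneg (a : 𝒜) : 0 ≤ r a := by
  rw [← hrun.reward_one 0 a]
  exact measureReal_nonneg

theorem mean_le_one (a : 𝒜) : r a ≤ 1 := by
  rw [← hrun.reward_one 0 a]
  exact measureReal_le_one

theorem reward_law (t : ℕ) (a : 𝒜) (b : Bool) :
    P {ω | R t a ω = if b then 1 else 0} = ENNReal.ofReal (bernoulliWeight (r a) b) := by
  rw [← ofReal_measureReal]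
  cases b
  · simpa [bernoulliWeight] using congrArg ENNReal.ofReal (hrun.reward_zero t a)
  · simpa [bernoulliWeight] using congrArg ENNReal.ofReal (hrun.reward_one t a)

theorem reward_mem (t : ℕ) (a : 𝒜) : ∀ᵐ ω ∂P, R t a ω = 1 ∨ R t a ω = 0 := by
  have hm : ∀ x : ℝ, MeasurableSet {ω | R t a ω = x} := fun x =>
    hrun.measurable_reward t a (measurableSet_singleton x)
  have h : P.real ({ω | R t a ω = 1} ∪ {ω | R t a ω = 0}) = 1 := by
    rw [measureReal_union _ (hm 0), hrun.reward_one, hrun.reward_zero]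
    · ring
    · rw [Set.disjoint_left]
      intro ω h1 h0
      simp only [Set.mem_ofPred_eq] at h1 h0
      rw [h1] at h0
      norm_num at h0
  have h2 : P ({ω | R t a ω = 1} ∪ {ω | R t a ω = 0}) = 1 := by
    rw [← ofReal_measureReal, h, ENNReal.ofReal_one]
  exact (mem_ae_iff_prob_eq_one ((hm 1).union (hm 0))).2 h2

/-! ### The law of one step -/

/-- The joint law of the arm played and the leading arm on an event of the past. -/
theorem choice_measure (t : ℕ) (a l : 𝒜) {A : Set Ω}
    (hA : MeasurableSet[history R arm lead t] A) :
    P (A ∩ {ω | arm t ω = a ∧ lead t ω = l}) = ∫⁻ ω in A, ENNReal.ofReal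
      (prob α p₀ R arm lead t ω a * leaderWeight (prob α p₀ R arm lead t ω) l) ∂P := by
  have hle := hrun.history_le t
  have hE : MeasurableSet {ω | arm t ω = a ∧ lead t ω = l} :=
    (hrun.measurable_arm t (measurableSet_singleton a)).inter
      (hrun.measurable_lead t (measurableSet_singleton l))
  have hint : Integrable (Set.indicator {ω | arm t ω = a ∧ lead t ω = l} fun _ => (1 : ℝ)) P :=
    (integrable_const 1).indicator hE
  have h1 := setIntegral_condExp hle hint hA
  have hc := hrun.choice_law t a l
  have hnn : 0 ≤ᵐ[P] fun ω =>
      prob α p₀ R arm lead t ω a * leaderWeight (prob α p₀ R arm lead t ω) l := by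
    have h2 : 0 ≤ᵐ[P] P[Set.indicator {ω | arm t ω = a ∧ lead t ω = l} (fun _ => (1 : ℝ)) |
        history R arm lead t] :=
      condExp_nonneg (Eventually.of_forall fun ω => Set.indicator_nonneg (fun _ _ => zero_le_one) ω)
    filter_upwards [h2, hc] with ω h3 h4
    rwa [h4] at h3
  have hint2 : Integrable (fun ω =>
      prob α p₀ R arm lead t ω a * leaderWeight (prob α p₀ R arm lead t ω) l) P :=
    integrable_condExp.congr hc
  rw [integral_congr_ae (ae_restrict_of_ae hc)] at h1
  replace h1 := h1.trans (integral_indicator_one hE)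
  rw [← ofReal_integral_eq_lintegral_ofReal hint2.integrableOn (ae_restrict_of_ae hnn), h1,
    ofReal_measureReal, Measure.restrict_apply hE, Set.inter_comm]

theorem measurableSet_branch (t : ℕ) (i : 𝒜 × 𝒜 × Bool) :
    MeasurableSet (branch R arm lead t i) :=
  ((hrun.measurable_arm t (measurableSet_singleton _)).inter
    (hrun.measurable_lead t (measurableSet_singleton _))).inter
    (hrun.measurable_reward t _ (measurableSet_singleton _))

theorem branch_measure (t : ℕ) (i : 𝒜 × 𝒜 × Bool) {A : Set Ω}
    (hA : MeasurableSet[history R arm lead t] A) :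
    P (A ∩ branch R arm lead t i) =
      ∫⁻ ω in A, ENNReal.ofReal (weight r (prob α p₀ R arm lead t ω) i) ∂P := by
  have hind := (Indep_iff _ _ P).1 (hrun.nonanticipating t)
    {ω | R t i.1 ω = if i.2.2 then 1 else 0} (A ∩ {ω | arm t ω = i.1 ∧ lead t ω = i.2.1})
    (le_iSup (fun a => MeasurableSpace.comap (R t a) inferInstance) i.1 _
      ⟨{if i.2.2 then 1 else 0}, measurableSet_singleton _, rfl⟩)
    (by
      refine MeasurableSet.inter ((le_sup_left.trans le_sup_left : history R arm lead t ≤ _) _ hA)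
        (MeasurableSet.inter ?_ ?_)
      · exact (le_sup_right.trans le_sup_left :
          MeasurableSpace.comap (arm t) inferInstance ≤ _) _
          ⟨{i.1}, measurableSet_singleton _, rfl⟩
      · exact (le_sup_right : MeasurableSpace.comap (lead t) inferInstance ≤ _) _
          ⟨{i.2.1}, measurableSet_singleton _, rfl⟩)
  rw [branch, ← Set.inter_assoc, Set.inter_comm, hind, hrun.reward_law, hrun.choice_measure t _ _ hA,
    ← lintegral_const_mul']
  · refine lintegral_congr fun ω => ?_
    rw [weight, mul_comm, ENNReal.ofReal_mul' (bernoulliWeight_nonneg (hrun.mean_nonneg _)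
      (hrun.mean_le_one _) _)]
  · exact ENNReal.ofReal_ne_top

theorem lintegral_branch (t : ℕ) (i : 𝒜 × 𝒜 × Bool) {g : Ω → ENNReal}
    (hg : Measurable[history R arm lead t] g) :
    ∫⁻ ω in branch R arm lead t i, g ω ∂P =
      ∫⁻ ω, ENNReal.ofReal (weight r (prob α p₀ R arm lead t ω) i) * g ω ∂P := by
  have hle := hrun.history_le t
  have hφ : Measurable fun ω => ENNReal.ofReal (weight r (prob α p₀ R arm lead t ω) i) :=
    ((measurable_weight r i).comp (hrun.measurable_prob t)).ennreal_ofReal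
  have h : (P.restrict (branch R arm lead t i)).trim hle =
      (P.withDensity fun ω => ENNReal.ofReal (weight r (prob α p₀ R arm lead t ω) i)).trim hle := by
    refine @Measure.ext _ (history R arm lead t) _ _ fun A hA => ?_
    rw [trim_measurableSet_eq hle hA, trim_measurableSet_eq hle hA,
      Measure.restrict_apply (hle _ hA), withDensity_apply _ (hle _ hA), hrun.branch_measure t i hA]
  rw [← lintegral_trim hle hg, h, lintegral_trim hle hg,
    lintegral_withDensity_eq_lintegral_mul _ hφ (hg.mono hle le_rfl)]
  rfl

theorem ae_mem_branch (t : ℕ) : ∀ᵐ ω ∂P, ω ∈ ⋃ i, branch R arm lead t i := by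
  filter_upwards [ae_all_iff.2 (hrun.reward_mem t)] with ω hω
  rw [Set.mem_iUnion]
  rcases hω (arm t ω) with h | h
  · exact ⟨(arm t ω, lead t ω, true), ⟨rfl, rfl⟩, by simpa using h⟩
  · exact ⟨(arm t ω, lead t ω, false), ⟨rfl, rfl⟩, by simpa using h⟩

/-- The one-step transition formula on an event of the past. -/
theorem setLIntegral_prob_succ (t : ℕ) {A : Set Ω} (hA : MeasurableSet[history R arm lead t] A)
    {f : (𝒜 → ℝ) → ENNReal} (hf : Measurable f) :
    ∫⁻ ω in A, f (prob α p₀ R arm lead (t + 1) ω) ∂P =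
      ∫⁻ ω in A, ∑ i, ENNReal.ofReal (weight r (prob α p₀ R arm lead t ω) i) *
        f (next α (prob α p₀ R arm lead t ω) i) ∂P := by
  have hA' := hrun.history_le t _ hA
  have hm : ∀ i, Measurable[history R arm lead t]
      fun ω => f (next α (prob α p₀ R arm lead t ω) i) := fun i =>
    hf.comp ((measurable_next α i).comp (Samba.measurable_prob α p₀ R arm lead t))
  have huniv : (⋃ i, branch R arm lead t i) =ᵐ[P] Set.univ :=
    eventuallyEq_univ.2 (hrun.ae_mem_branch t)
  calc ∫⁻ ω in A, f (prob α p₀ R arm lead (t + 1) ω) ∂P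
      = ∫⁻ ω in ⋃ i, branch R arm lead t i,
          A.indicator (fun ω => f (prob α p₀ R arm lead (t + 1) ω)) ω ∂P := by
        rw [Measure.restrict_congr_set huniv, Measure.restrict_univ, lintegral_indicator hA']
    _ = ∑ i, ∫⁻ ω in branch R arm lead t i,
          A.indicator (fun ω => f (next α (prob α p₀ R arm lead t ω) i)) ω ∂P := by
        rw [lintegral_iUnion (hrun.measurableSet_branch t) (pairwise_disjoint_branch R arm lead t),
          tsum_fintype]
        refine Finset.sum_congr rfl fun i _ => ?_
        refine setLIntegral_congr_fun (hrun.measurableSet_branch t i) fun ω hω => ?_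
        simp only [Set.indicator, prob_succ_of_mem_branch hω]
    _ = ∑ i, ∫⁻ ω in A, ENNReal.ofReal (weight r (prob α p₀ R arm lead t ω) i) *
          f (next α (prob α p₀ R arm lead t ω) i) ∂P := by
        refine Finset.sum_congr rfl fun i _ => ?_
        rw [hrun.lintegral_branch t i ((hm i).indicator hA), ← lintegral_indicator hA']
        refine lintegral_congr fun ω => ?_
        by_cases hω : ω ∈ A <;> simp [hω]
    _ = _ := by
        rw [lintegral_finsetSum _ fun i _ => ?_]
        exact ((measurable_weight r i).comp (hrun.measurable_prob t)).ennreal_ofReal.mul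
          ((hm i).mono (hrun.history_le t) le_rfl)

theorem ae_lead_mem_leaders (t : ℕ) :
    ∀ᵐ ω ∂P, lead t ω ∈ leaders (prob α p₀ R arm lead t ω) := by
  have hA : ∀ l, MeasurableSet[history R arm lead t]
      {ω | l ∉ leaders (prob α p₀ R arm lead t ω)} := fun l =>
    Samba.measurable_prob α p₀ R arm lead t (measurableSet_mem_leaders l).compl
  have h : ∀ a l, ∀ᵐ ω ∂P, ¬ (l ∉ leaders (prob α p₀ R arm lead t ω) ∧
      arm t ω = a ∧ lead t ω = l) := by
    intro a l
    rw [ae_iff]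
    simp only [not_not]
    refine (hrun.choice_measure t a l (hA l)).trans ?_
    rw [setLIntegral_congr_fun (g := fun _ => 0) (hrun.history_le t _ (hA l)), lintegral_zero]
    intro ω hω
    simp [leaderWeight_of_notMem hω]
  filter_upwards [ae_all_iff.2 fun a => ae_all_iff.2 (h a)] with ω hω
  by_contra hl
  exact hω (arm t ω) (lead t ω) ⟨hl, rfl, rfl⟩

theorem ae_openSimplex (hα0 : 0 < α) (hα1 : α < 1) (hp₀ : OpenSimplex p₀) :
    ∀ᵐ ω ∂P, ∀ t, OpenSimplex (prob α p₀ R arm lead t ω) := by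
  filter_upwards [ae_all_iff.2 hrun.ae_mem_branch, ae_all_iff.2 hrun.ae_lead_mem_leaders]
    with ω h1 h2 t
  induction t with
  | zero => exact hp₀
  | succ t ih =>
    obtain ⟨i, hi⟩ := Set.mem_iUnion.1 (h1 t)
    rw [prob_succ_of_mem_branch hi]
    have hl := h2 t
    rw [hi.1.2] at hl
    refine ih.step hα0 hα1 hl i.1 ?_ ?_ <;> split_ifs <;> norm_num

theorem isMarkovChain [Nonempty 𝒜] (hα0 : 0 < α) (hα1 : α < 1) (hp₀ : OpenSimplex p₀) :
    IsMarkovChain P (history R arm lead) (prob α p₀ R arm lead) := by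
  have hK : IsMarkovKernel (transition r α) :=
    isMarkovKernel_transition hrun.mean_nonneg hrun.mean_le_one
  refine ⟨history_mono R arm lead, hrun.history_le, Samba.measurable_prob α p₀ R arm lead,
    transition r α, hK, fun t B hB => ?_⟩
  have hle := hrun.history_le t
  have hmB : MeasurableSet (prob α p₀ R arm lead (t + 1) ⁻¹' B) := hrun.measurable_prob (t + 1) hB
  have hmκ : Measurable[history R arm lead t]
      fun ω => (transition r α (prob α p₀ R arm lead t ω)) B :=
    ((transition r α).measurable_coe hB).comp (Samba.measurable_prob α p₀ R arm lead t)
  have hmκ' := hmκ.mono hle le_rfl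
  refine (ae_eq_condExp_of_forall_setIntegral_eq hle ((integrable_const 1).indicator hmB)
    (fun A _ _ => ?_) (fun A hA _ => ?_) ?_).symm
  · refine Integrable.integrableOn (Integrable.of_bound hmκ'.ennreal_toReal.aestronglyMeasurable 1
      (Eventually.of_forall fun ω => ?_))
    rw [Real.norm_of_nonneg measureReal_nonneg]
    exact measureReal_le_one
  · have h1 := hrun.setLIntegral_prob_succ t hA (f := B.indicator 1) (measurable_one.indicator hB)
    have h2 : ∫⁻ ω in A, ∑ i, ENNReal.ofReal (weight r (prob α p₀ R arm lead t ω) i) *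
        B.indicator 1 (next α (prob α p₀ R arm lead t ω) i) ∂P =
        ∫⁻ ω in A, transition r α (prob α p₀ R arm lead t ω) B ∂P := by
      refine lintegral_congr_ae (ae_restrict_of_ae ?_)
      filter_upwards [hrun.ae_openSimplex hα0 hα1 hp₀] with ω hω
      rw [transition_apply (hω t).mem_stdSimplex hB]
    have h3 : ∫⁻ ω in A, B.indicator 1 (prob α p₀ R arm lead (t + 1) ω) ∂P =
        (P.restrict A) (prob α p₀ R arm lead (t + 1) ⁻¹' B) := by
      rw [← lintegral_indicator_one hmB]
      rfl
    refine Eq.trans ?_ (integral_indicator_one hmB).symm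
    rw [measureReal_def, ← h3, h1, h2]
    exact integral_toReal hmκ'.aemeasurable (Eventually.of_forall fun ω => measure_lt_top _ _)
  · exact (Measurable.stronglyMeasurable (mα := history R arm lead t)
      hmκ.ennreal_toReal).aestronglyMeasurable

/-- A pointwise bound on the one-step expectation is inherited by the expectations along the
run. -/
theorem lintegral_succ_add_le (hα0 : 0 < α) (hα1 : α < 1) (hp₀ : OpenSimplex p₀)
    {f g h : (𝒜 → ℝ) → ℝ} (hf : Measurable f) (hh : Measurable h)
    (hf0 : ∀ p, OpenSimplex p → 0 ≤ f p) (hh0 : ∀ p, 0 ≤ h p)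
    (hle : ∀ p, OpenSimplex p → expectNext r α f p + h p ≤ g p) (t : ℕ) :
    ∫⁻ ω, ENNReal.ofReal (f (prob α p₀ R arm lead (t + 1) ω)) ∂P +
      ∫⁻ ω, ENNReal.ofReal (h (prob α p₀ R arm lead t ω)) ∂P ≤
      ∫⁻ ω, ENNReal.ofReal (g (prob α p₀ R arm lead t ω)) ∂P := by
  have h1 := hrun.setLIntegral_prob_succ t (f := fun p => ENNReal.ofReal (f p))
    (@MeasurableSet.univ _ (history R arm lead t)) hf.ennreal_ofReal
  simp only [Measure.restrict_univ] at h1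
  have hhm : Measurable fun ω => ENNReal.ofReal (h (prob α p₀ R arm lead t ω)) :=
    (hh.comp (hrun.measurable_prob t)).ennreal_ofReal
  rw [h1, ← lintegral_add_right _ hhm]
  refine lintegral_mono_ae ?_
  filter_upwards [hrun.ae_openSimplex hα0 hα1 hp₀] with ω hω
  have hw := weight_nonneg hrun.mean_nonneg hrun.mean_le_one (fun a => ((hω t).1 a).le)
  have hwf : ∀ i, 0 ≤ weight r (prob α p₀ R arm lead t ω) i *
      f (next α (prob α p₀ R arm lead t ω) i) := by
    intro i
    by_cases hi : weight r (prob α p₀ R arm lead t ω) i = 0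
    · simp [hi]
    · exact mul_nonneg (hw i) (hf0 _ ((hω t).next hα0 hα1 hi))
  simp only [← ENNReal.ofReal_mul (hw _)]
  rw [← ENNReal.ofReal_sum_of_nonneg fun i _ => hwf i,
    ← ENNReal.ofReal_add (Finset.sum_nonneg fun i _ => hwf i) (hh0 _)]
  exact ENNReal.ofReal_le_ofReal (hle _ (hω t))

end IsRun

end

section

variable {𝒜 : Type*} [Fintype 𝒜]

/-! ### The gap -/

theorem le_sub_gap (r : 𝒜 → ℝ) {aStar a : 𝒜} (ha : a ≠ aStar) : r a ≤ r aStar - gap r aStar := by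
  rw [gap, sub_sub_cancel]
  exact le_ciSup (f := fun a : {a : 𝒜 // a ≠ aStar} => r a) (Set.finite_range _).bddAbove ⟨a, ha⟩

theorem exists_eq_sub_gap [Nontrivial 𝒜] (r : 𝒜 → ℝ) (aStar : 𝒜) :
    ∃ a, a ≠ aStar ∧ r a = r aStar - gap r aStar := by
  obtain ⟨b, hb⟩ := exists_ne aStar
  have : Nonempty {a : 𝒜 // a ≠ aStar} := ⟨⟨b, hb⟩⟩
  obtain ⟨a, ha⟩ := exists_eq_ciSup_of_finite (f := fun a : {a : 𝒜 // a ≠ aStar} => r a)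
  exact ⟨a, a.2, by rw [ha, gap, sub_sub_cancel]⟩

variable [DecidableEq 𝒜] [MeasurableSpace 𝒜] [MeasurableSingletonClass 𝒜]
  {Ω : Type*} [MeasurableSpace Ω] {P : Measure Ω} [IsProbabilityMeasure P]
  {r : 𝒜 → ℝ} {α : ℝ} {p₀ : 𝒜 → ℝ} {R : ℕ → 𝒜 → Ω → ℝ} {arm lead : ℕ → Ω → 𝒜} {s : 𝒜} {Δ : ℝ}

namespace IsRun

/-! ### Summation along the run -/

/-- Telescoping: a nonnegative function whose one-step expectation decreases by at least `h` bounds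
the expected sum of `h` along the run. -/
theorem tsum_lintegral_le (hrun : IsRun P r α p₀ R arm lead) (hα0 : 0 < α) (hα1 : α < 1)
    (hp₀ : OpenSimplex p₀) {f h : (𝒜 → ℝ) → ℝ} (hf : Measurable f) (hh : Measurable h)
    (hf0 : ∀ p, OpenSimplex p → 0 ≤ f p) (hh0 : ∀ p, 0 ≤ h p)
    (hle : ∀ p, OpenSimplex p → expectNext r α f p + h p ≤ f p) :
    ∑' t, ∫⁻ ω, ENNReal.ofReal (h (prob α p₀ R arm lead t ω)) ∂P ≤ ENNReal.ofReal (f p₀) := by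
  have key : ∀ n, ∑ t ∈ Finset.range n,
      ∫⁻ ω, ENNReal.ofReal (h (prob α p₀ R arm lead t ω)) ∂P +
      ∫⁻ ω, ENNReal.ofReal (f (prob α p₀ R arm lead n ω)) ∂P ≤ ENNReal.ofReal (f p₀) := by
    intro n
    induction n with
    | zero => simp [prob]
    | succ n ih =>
      refine le_trans ?_ ih
      rw [Finset.sum_range_succ, add_assoc, add_comm (∫⁻ ω, _ ∂P)]
      gcongr
      exact hrun.lintegral_succ_add_le hα0 hα1 hp₀ hf hh hf0 hh0 hle n
  rw [ENNReal.tsum_eq_iSup_nat]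
  exact iSup_le fun n => le_self_add.trans (key n)

/-- Finiteness of the expected number of times at which the optimal arm has probability at most
`1 / 2`, from the Lyapunov function. -/
theorem Q_lt_top [Nontrivial 𝒜] (hrun : IsRun P r α p₀ R arm lead) (hα0 : 0 < α) (hα1 : α < 1)
    (hp₀ : OpenSimplex p₀) (hΔ : 0 < Δ) (hr : ∀ a, a ≠ s → r a ≤ r s - Δ)
    (hrα : (1 + α) * (r s - Δ) < r s) : Q P (prob α p₀ R arm lead) s < ⊤ := by
  classical
  obtain ⟨M, η, hM, hη, hle⟩ :=
    exists_lyapunov hα0 hα1 hrun.mean_nonneg hrun.mean_le_one hΔ hr hrα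
  have hms : MeasurableSet {p : 𝒜 → ℝ | p s ≤ 1 / 2} :=
    measurableSet_le (measurable_pi_apply s) measurable_const
  have h1 := hrun.tsum_lintegral_le hα0 hα1 hp₀ (f := lyapunov M s)
    (h := fun p => if p s ≤ 1 / 2 then η else 0)
    (((measurable_pi_apply s).inv).add
      (measurable_const.mul (measurable_const.sub (measurable_pi_apply s))))
    (Measurable.ite hms measurable_const measurable_const)
    (fun p hp => add_nonneg (inv_nonneg.2 (hp.1 s).le)
      (mul_nonneg hM (by linarith [hp.le_one s])))
    (fun p => by split_ifs <;> positivity) hle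
  have h2 : ∀ t, ∫⁻ ω, ENNReal.ofReal (if prob α p₀ R arm lead t ω s ≤ 1 / 2 then η else 0) ∂P =
      ENNReal.ofReal η * P {ω | prob α p₀ R arm lead t ω s ≤ 1 / 2} := by
    intro t
    have hms' : MeasurableSet {ω | prob α p₀ R arm lead t ω s ≤ 1 / 2} :=
      hrun.measurable_prob t hms
    rw [← lintegral_indicator_const hms']
    refine lintegral_congr fun ω => ?_
    simp only [Set.indicator, Set.mem_ofPred_eq]
    split_ifs
    · rfl
    · exact ENNReal.ofReal_zero
  simp only [h2, ENNReal.tsum_mul_left] at h1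
  refine lt_top_iff_ne_top.2 fun htop => ?_
  rw [Q] at htop
  rw [htop, ENNReal.mul_top (ENNReal.ofReal_pos.2 hη).ne', top_le_iff] at h1
  exact ENNReal.ofReal_ne_top h1

theorem tendsto_one [Nontrivial 𝒜] (hrun : IsRun P r α p₀ R arm lead) (hα0 : 0 < α) (hα1 : α < 1)
    (hp₀ : OpenSimplex p₀) (hΔ : 0 < Δ) (hr : ∀ a, a ≠ s → r a ≤ r s - Δ)
    (hQ : Q P (prob α p₀ R arm lead) s < ⊤) :
    ∀ᵐ ω ∂P, Tendsto (fun t => prob α p₀ R arm lead t ω s) atTop (𝓝 1) := by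
  obtain ⟨c, hc⟩ : ∃ c, c = α * Δ / ((Fintype.card 𝒜 : ℝ) - 1) := ⟨_, rfl⟩
  have hn : (1 : ℝ) < Fintype.card 𝒜 := by exact_mod_cast Fintype.one_lt_card
  have hc0 : 0 < c := by
    rw [hc]
    exact div_pos (mul_pos hα0 hΔ) (by linarith)
  obtain ⟨h, hh⟩ : ∃ h : (𝒜 → ℝ) → ℝ,
      h = fun p => if 1 / 2 < p s then c * truncSubopt s p ^ 2 else 0 := ⟨_, rfl⟩
  have hhm : Measurable h := by
    rw [hh]
    exact Measurable.ite (measurableSet_half_lt s)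
      (((measurable_truncSubopt s).pow_const 2).const_mul c) measurable_const
  have h1 := hrun.tsum_lintegral_le hα0 hα1 hp₀ (measurable_truncSubopt s) hhm
    (fun p hp => truncSubopt_nonneg hp s) (fun p => by rw [hh]; positivity) (fun p hp => by
      rw [hh, hc]
      exact expectNext_truncSubopt_le hα0 hα1 hrun.mean_nonneg hrun.mean_le_one hΔ hr hp)
  have hmt : ∀ t, Measurable fun ω => ENNReal.ofReal (h (prob α p₀ R arm lead t ω)) := fun t =>
    (hhm.comp (hrun.measurable_prob t)).ennreal_ofReal
  rw [← lintegral_tsum fun t => (hmt t).aemeasurable] at h1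
  have h2 := ae_lt_top (Measurable.tsum hmt) (h1.trans_lt ENNReal.ofReal_lt_top).ne
  filter_upwards [h2, ae_eventually_notMem hQ.ne, hrun.ae_openSimplex hα0 hα1 hp₀]
    with ω hω hev hop
  have h3 := ENNReal.tendsto_atTop_zero_of_tsum_ne_top hω.ne
  have h4 := (ENNReal.tendsto_toReal ENNReal.zero_ne_top).comp h3
  have h5 : Tendsto (fun t => c * (1 - prob α p₀ R arm lead t ω s) ^ 2) atTop (𝓝 0) := by
    refine h4.congr' ?_
    filter_upwards [hev] with t ht
    have ht' : 1 / 2 < prob α p₀ R arm lead t ω s := not_le.1 ht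
    rw [Function.comp_apply, hh]
    simp only [if_pos ht', truncSubopt_of_lt ht']
    exact ENNReal.toReal_ofReal (by positivity)
  have h6 : Tendsto (fun t => 1 - prob α p₀ R arm lead t ω s) atTop (𝓝 0) := by
    have h7 := (h5.const_mul c⁻¹).sqrt
    simp only [← mul_assoc, inv_mul_cancel₀ hc0.ne', one_mul, mul_zero, Real.sqrt_zero] at h7
    refine h7.congr fun t => Real.sqrt_sq ?_
    linarith [(hop t).le_one s]
  simpa using h6.const_sub 1

/-! ### The regret -/

theorem sum_lintegral_le_potential [Nontrivial 𝒜] (hrun : IsRun P r α p₀ R arm lead)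
    (hα0 : 0 < α) (hα1 : α < 1)
    (hp₀ : OpenSimplex p₀) (hΔ : 0 < Δ) (hr : ∀ a, a ≠ s → r a ≤ r s - Δ) {c : ℝ}
    (hc : c = α * Δ / ((Fintype.card 𝒜 : ℝ) - 1)) (hc0 : 0 ≤ c) (hc1 : c ≤ 1) (T : ℕ) :
    ∑ t ∈ Finset.range T, ∫⁻ ω, ENNReal.ofReal (if 1 / 2 < prob α p₀ R arm lead t ω s then
      1 - prob α p₀ R arm lead t ω s else 0) ∂P ≤
      ENNReal.ofReal (potential c T (truncSubopt s p₀)) := by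
  have hmh : Measurable fun p : 𝒜 → ℝ => if 1 / 2 < p s then max (1 - p s) 0 else 0 :=
    Measurable.ite (measurableSet_half_lt s)
      ((measurable_const.sub (measurable_pi_apply s)).max measurable_const) measurable_const
  have hmf : ∀ j, Measurable fun p : 𝒜 → ℝ => potential c j (truncSubopt s p) := fun j =>
    Finset.measurable_sum _ fun i _ => (measurable_truncSubopt s).div
      (measurable_const.add ((measurable_truncSubopt s).const_mul _))
  have key : ∀ n j, ∑ t ∈ Finset.range n,
      ∫⁻ ω, ENNReal.ofReal (if 1 / 2 < prob α p₀ R arm lead t ω s then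
        max (1 - prob α p₀ R arm lead t ω s) 0 else 0) ∂P +
      ∫⁻ ω, ENNReal.ofReal (potential c j (truncSubopt s (prob α p₀ R arm lead n ω))) ∂P ≤
      ENNReal.ofReal (potential c (j + n) (truncSubopt s p₀)) := by
    intro n
    induction n with
    | zero => simp [prob]
    | succ n ih =>
      intro j
      refine le_trans ?_ ((ih (j + 1)).trans_eq (by rw [add_right_comm, add_assoc]))
      rw [Finset.sum_range_succ, add_assoc, add_comm (∫⁻ ω, _ ∂P)]
      gcongr
      refine hrun.lintegral_succ_add_le hα0 hα1 hp₀
        (g := fun p => potential c (j + 1) (truncSubopt s p)) (hmf j) hmh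
        (fun p hp => potential_nonneg hc0 (truncSubopt_nonneg hp s) j)
        (fun p => by split_ifs <;> simp) (fun p hp => ?_) n
      rw [max_eq_left (by linarith [hp.le_one s])]
      exact expectNext_potential_add_le hα0 hα1 hrun.mean_nonneg hrun.mean_le_one hΔ hr hc hc0 hc1
        hp j
  refine le_trans ?_ (le_self_add.trans ((key T 0).trans_eq (by rw [zero_add])))
  refine Finset.sum_le_sum fun t _ => lintegral_mono fun ω => ENNReal.ofReal_le_ofReal ?_
  split_ifs
  · exact le_max_left _ _
  · exact le_rfl

theorem integrable_prob (hrun : IsRun P r α p₀ R arm lead) (hα0 : 0 < α) (hα1 : α < 1)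
    (hp₀ : OpenSimplex p₀) (t : ℕ) (a : 𝒜) :
    Integrable (fun ω => prob α p₀ R arm lead t ω a) P := by
  refine Integrable.of_bound
    ((measurable_pi_apply a).comp (hrun.measurable_prob t)).aestronglyMeasurable 1 ?_
  filter_upwards [hrun.ae_openSimplex hα0 hα1 hp₀] with ω hω
  rw [Real.norm_of_nonneg ((hω t).1 a).le]
  exact (hω t).le_one a

theorem observed_ae_eq (hrun : IsRun P r α p₀ R arm lead) (t : ℕ) (a : 𝒜) :
    (fun ω => observed R arm t ω a) =ᵐ[P]
      Set.indicator (⋃ l, branch R arm lead t (a, l, true)) 1 := by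
  filter_upwards [hrun.reward_mem t a] with ω hω
  have hiff : ω ∈ ⋃ l, branch R arm lead t (a, l, true) ↔ arm t ω = a ∧ R t a ω = 1 := by
    simp [branch]
  by_cases ha : arm t ω = a
  · rcases hω with h | h <;> simp [observed, Set.indicator, hiff, ha, h]
  · simp [observed, Set.indicator, hiff, ha]

theorem measurableSet_iUnion_branch (hrun : IsRun P r α p₀ R arm lead) (t : ℕ) (a : 𝒜) :
    MeasurableSet (⋃ l, branch R arm lead t (a, l, true)) :=
  MeasurableSet.iUnion fun _ => hrun.measurableSet_branch t _

theorem integrable_observed (hrun : IsRun P r α p₀ R arm lead) (t : ℕ) (a : 𝒜) :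
    Integrable (fun ω => observed R arm t ω a) P :=
  ((integrable_const (1 : ℝ)).indicator (hrun.measurableSet_iUnion_branch t a)).congr
    (hrun.observed_ae_eq t a).symm

theorem integral_observed [Nonempty 𝒜] (hrun : IsRun P r α p₀ R arm lead) (hα0 : 0 < α)
    (hα1 : α < 1) (hp₀ : OpenSimplex p₀) (t : ℕ) (a : 𝒜) :
    ∫ ω, observed R arm t ω a ∂P = ∫ ω, prob α p₀ R arm lead t ω a * r a ∂P := by
  rw [integral_congr_ae (hrun.observed_ae_eq t a),
    integral_indicator_one (hrun.measurableSet_iUnion_branch t a), measureReal_def,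
    measure_iUnion _ fun _ => hrun.measurableSet_branch t _, tsum_fintype]
  · have h1 : ∀ l, P (branch R arm lead t (a, l, true)) =
        ∫⁻ ω, ENNReal.ofReal (weight r (prob α p₀ R arm lead t ω) (a, l, true)) ∂P := by
      intro l
      have h := hrun.branch_measure t (a, l, true) (@MeasurableSet.univ _ (history R arm lead t))
      rwa [Set.univ_inter, Measure.restrict_univ] at h
    simp only [h1]
    have hm : ∀ l, Measurable fun ω =>
        ENNReal.ofReal (weight r (prob α p₀ R arm lead t ω) (a, l, true)) := fun l =>
      ((measurable_weight r _).comp (hrun.measurable_prob t)).ennreal_ofReal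
    rw [← lintegral_finsetSum _ fun l _ => hm l]
    have hae := hrun.ae_openSimplex hα0 hα1 hp₀
    rw [integral_eq_lintegral_of_nonneg_ae]
    · congr 1
      refine lintegral_congr_ae ?_
      filter_upwards [hae] with ω hω
      rw [← ENNReal.ofReal_sum_of_nonneg fun l _ => weight_nonneg hrun.mean_nonneg
        hrun.mean_le_one (fun b => ((hω t).1 b).le) _]
      congr 1
      simp only [weight, bernoulliWeight, if_true]
      rw [← Finset.sum_mul, ← Finset.mul_sum, sum_leaderWeight, mul_one]
    · filter_upwards [hae] with ω hω
      exact mul_nonneg ((hω t).1 a).le (hrun.mean_nonneg a)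
    · exact ((hrun.integrable_prob hα0 hα1 hp₀ t a).mul_const _).aestronglyMeasurable
  · intro l l' hll
    exact pairwise_disjoint_branch R arm lead t fun h => hll (by simpa using h)

/-- The regret of a single round is at most the probability of the suboptimal arms. -/
theorem regret_le_sum_integral [Nonempty 𝒜] (hrun : IsRun P r α p₀ R arm lead) (hα0 : 0 < α)
    (hα1 : α < 1) (hp₀ : OpenSimplex p₀) (s : 𝒜) (T : ℕ) :
    regret P r s R arm T ≤
      ∑ t ∈ Finset.range T, ∫ ω, (1 - prob α p₀ R arm lead t ω s) ∂P := by
  rw [regret, integral_finsetSum _ fun t _ => integrable_finsetSum _ fun a _ =>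
    hrun.integrable_observed t a]
  have h1 : r s * T = ∑ _t ∈ Finset.range T, r s := by simp [mul_comm]
  rw [h1, ← Finset.sum_sub_distrib]
  refine Finset.sum_le_sum fun t _ => ?_
  have hint := hrun.integrable_prob hα0 hα1 hp₀ t
  rw [integral_finsetSum _ fun a _ => hrun.integrable_observed t a]
  simp only [hrun.integral_observed hα0 hα1 hp₀ t]
  rw [← integral_finsetSum _ fun a _ => (hint a).mul_const _]
  have h2 : r s = ∫ _ω, r s ∂P := by simp
  rw [h2, ← integral_sub (integrable_const _)
    (integrable_finsetSum _ fun a _ => (hint a).mul_const _)]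
  refine integral_mono_ae ((integrable_const _).sub
    (integrable_finsetSum _ fun a _ => (hint a).mul_const _))
    ((integrable_const _).sub (hint s)) ?_
  filter_upwards [hrun.ae_openSimplex hα0 hα1 hp₀] with ω hω
  have h3 : prob α p₀ R arm lead t ω s * r s ≤ ∑ a, prob α p₀ R arm lead t ω a * r a :=
    Finset.single_le_sum (f := fun a => prob α p₀ R arm lead t ω a * r a)
      (fun a _ => mul_nonneg ((hω t).1 a).le (hrun.mean_nonneg a)) (Finset.mem_univ s)
  have h4 : (1 - prob α p₀ R arm lead t ω s) * r s ≤ 1 - prob α p₀ R arm lead t ω s :=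
    mul_le_of_le_one_right (by linarith [(hω t).le_one s]) (hrun.mean_le_one s)
  change r s - ∑ a, prob α p₀ R arm lead t ω a * r a ≤ 1 - prob α p₀ R arm lead t ω s
  linarith

/-- The rounds in which the optimal arm has probability at most `1 / 2` cost at most `Q`; the
potential bounds the cost of the others. -/
theorem regret_le_potential [Nontrivial 𝒜] (hrun : IsRun P r α p₀ R arm lead) (hα0 : 0 < α)
    (hα1 : α < 1) (hp₀ : OpenSimplex p₀) (hQ : Q P (prob α p₀ R arm lead) s < ⊤) {U : ℝ}
    (hU0 : 0 ≤ U) (T : ℕ)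
    (hU : ∑ t ∈ Finset.range T, ∫⁻ ω, ENNReal.ofReal (if 1 / 2 < prob α p₀ R arm lead t ω s then
      1 - prob α p₀ R arm lead t ω s else 0) ∂P ≤ ENNReal.ofReal U) :
    regret P r s R arm T ≤ U + (Q P (prob α p₀ R arm lead) s).toReal := by
  refine (hrun.regret_le_sum_integral hα0 hα1 hp₀ s T).trans ?_
  have hae := hrun.ae_openSimplex hα0 hα1 hp₀
  have hms : ∀ t, MeasurableSet {ω | prob α p₀ R arm lead t ω s ≤ 1 / 2} := fun t =>
    measurableSet_le ((measurable_pi_apply s).comp (hrun.measurable_prob t)) measurable_const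
  have hnn : ∀ t, 0 ≤ ∫ ω, (1 - prob α p₀ R arm lead t ω s) ∂P := fun t =>
    integral_nonneg_of_ae (by
      filter_upwards [hae] with ω hω
      simpa using (hω t).le_one s)
  have h1 : ∀ t, ENNReal.ofReal (∫ ω, (1 - prob α p₀ R arm lead t ω s) ∂P) ≤
      ∫⁻ ω, ENNReal.ofReal (if 1 / 2 < prob α p₀ R arm lead t ω s then
        1 - prob α p₀ R arm lead t ω s else 0) ∂P +
        P {ω | prob α p₀ R arm lead t ω s ≤ 1 / 2} := by
    intro t
    have hint : Integrable (fun ω => 1 - prob α p₀ R arm lead t ω s) P :=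
      (integrable_const _).sub (hrun.integrable_prob hα0 hα1 hp₀ t s)
    rw [ofReal_integral_eq_lintegral_ofReal hint,
      ← lintegral_indicator_one (hms t),
      ← lintegral_add_right _ (measurable_one.indicator (hms t))]
    · refine lintegral_mono_ae ?_
      filter_upwards [hae] with ω hω
      by_cases h : 1 / 2 < prob α p₀ R arm lead t ω s
      · rw [if_pos h]
        exact le_self_add
      · have h' : ω ∈ {ω | prob α p₀ R arm lead t ω s ≤ 1 / 2} := not_lt.1 h
        rw [if_neg h, Set.indicator_of_mem h', ENNReal.ofReal_zero, zero_add, Pi.one_apply,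
          ENNReal.ofReal_le_one]
        linarith [(hω t).1 s]
    · filter_upwards [hae] with ω hω
      simpa using (hω t).le_one s
  rw [← ENNReal.ofReal_le_ofReal_iff (by positivity), ENNReal.ofReal_add hU0 (by positivity),
    ENNReal.ofReal_toReal hQ.ne, ENNReal.ofReal_sum_of_nonneg fun t _ => hnn t]
  refine (Finset.sum_le_sum fun t _ => h1 t).trans ?_
  rw [Finset.sum_add_distrib]
  exact add_le_add hU (ENNReal.sum_le_tsum _)

end IsRun

end

end Samba

theorem theorem1 {𝒜 : Type*} [Fintype 𝒜] [DecidableEq 𝒜] [Nontrivial 𝒜]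
    [MeasurableSpace 𝒜] [MeasurableSingletonClass 𝒜]
    {Ω : Type*} [MeasurableSpace Ω] (P : Measure Ω) [IsProbabilityMeasure P]
    (r : 𝒜 → ℝ) (aStar : 𝒜) (hopt : ∀ a, a ≠ aStar → r a < r aStar)
    (α : ℝ) (hα0 : 0 < α) (hα1 : α < 1)
    -- the bound is `+∞` when its denominator vanishes
    (hα : r aStar - Samba.gap r aStar ≠ 0 →
      α < Samba.gap r aStar / (r aStar - Samba.gap r aStar))
    (p₀ : 𝒜 → ℝ) (hp₀ : ∀ a, 0 < p₀ a) (hp₀_sum : ∑ a, p₀ a = 1)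
    (R : ℕ → 𝒜 → Ω → ℝ) (arm lead : ℕ → Ω → 𝒜)
    (hrun : Samba.IsRun P r α p₀ R arm lead) :
    (∀ᵐ ω ∂P, ∀ t, Samba.prob α p₀ R arm lead t ω ∈ stdSimplex ℝ 𝒜) ∧
    Samba.IsMarkovChain P (Samba.history R arm lead) (Samba.prob α p₀ R arm lead) ∧
    (∀ᵐ ω ∂P, Tendsto (fun t => Samba.prob α p₀ R arm lead t ω aStar) atTop (𝓝 1)) ∧
    Samba.Q P (Samba.prob α p₀ R arm lead) aStar < ⊤ ∧
    ∀ T : ℕ, 1 ≤ T → (2 ≤ T ∨ p₀ aStar ≤ 1 / 2) →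
      Samba.regret P r aStar R arm T ≤
        (Fintype.card 𝒜 : ℝ) / (α * Samba.gap r aStar) * Real.log T +
          (Samba.Q P (Samba.prob α p₀ R arm lead) aStar).toReal := by
  have hop : Samba.OpenSimplex p₀ := ⟨hp₀, hp₀_sum⟩
  have hr : ∀ a, a ≠ aStar → r a ≤ r aStar - Samba.gap r aStar := fun a => Samba.le_sub_gap r
  obtain ⟨b, hb, hbr⟩ := Samba.exists_eq_sub_gap r aStar
  have hb0 : 0 ≤ r aStar - Samba.gap r aStar := hbr ▸ hrun.mean_nonneg b
  have hs1 := hrun.mean_le_one aStar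
  have hΔ : 0 < Samba.gap r aStar := by linarith [hopt b hb]
  generalize Samba.gap r aStar = Δ at *
  have hrα : (1 + α) * (r aStar - Δ) < r aStar := by
    rcases eq_or_ne (r aStar - Δ) 0 with h | h
    · rw [h]
      linarith
    · have h1 := hα h
      rw [lt_div_iff₀ (lt_of_le_of_ne hb0 h.symm)] at h1
      linarith
  have hQ := hrun.Q_lt_top hα0 hα1 hop hΔ hr hrα
  refine ⟨?_, hrun.isMarkovChain hα0 hα1 hop, hrun.tendsto_one hα0 hα1 hop hΔ hr hQ, hQ,
    fun T hT hT2 => ?_⟩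
  · filter_upwards [hrun.ae_openSimplex hα0 hα1 hop] with ω hω t
    exact (hω t).mem_stdSimplex
  have hlog : 0 ≤ Real.log T := Real.log_nonneg (by exact_mod_cast hT)
  refine hrun.regret_le_potential hα0 hα1 hop hQ (by positivity) T ?_
  rcases lt_or_ge 1 T with h2 | h2
  · obtain ⟨c, hc⟩ : ∃ c, c = α * Δ / ((Fintype.card 𝒜 : ℝ) - 1) := ⟨_, rfl⟩
    have hn : (2 : ℝ) ≤ Fintype.card 𝒜 := by exact_mod_cast Fintype.one_lt_card (α := 𝒜)
    have hαΔ : α * Δ ≤ 1 := by nlinarith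
    have hc0 : 0 ≤ c := by
      rw [hc]
      exact div_nonneg (by positivity) (by linarith)
    have hc1 : c ≤ 1 := by
      rw [hc, div_le_one (by linarith)]
      linarith
    refine (hrun.sum_lintegral_le_potential hα0 hα1 hop hΔ hr hc hc0 hc1 T).trans
      (ENNReal.ofReal_le_ofReal ?_)
    exact (Samba.potential_mono hc0 (Samba.truncSubopt_nonneg hop aStar)
      (Samba.truncSubopt_le_half aStar p₀) T).trans
      (Samba.potential_half_le_log (by linarith) (by positivity) hαΔ hc hc1 h2)
  -- In the single round `t = 0` the optimal arm has probability at most `1 / 2`.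
  · obtain rfl : T = 1 := by omega
    have h1 : ¬ 1 / 2 < p₀ aStar := not_lt.2 (hT2.resolve_left (by omega))
    have h0 : ∀ ω, (if 1 / 2 < Samba.prob α p₀ R arm lead 0 ω aStar then
        1 - Samba.prob α p₀ R arm lead 0 ω aStar else 0) = 0 := fun ω => if_neg h1
    simp only [Finset.sum_range_one, h0, ENNReal.ofReal_zero, lintegral_zero, zero_le]
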